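/- **Conventions.** $f ⨟ g$ means "first $f$, then $g$". Let $\mathcal V$, $\mathcal W$ be symmetric monoidal categories and $F:\mathcal V\to\mathcal W$ a (lax) symmetric monoidal functor with comparison maps $F_\varepsilon: I\to FI$ and $\tilde F: FA\otimes FB\to F(A\otimes B)$. Let $M$ be a symmetric monoidal monad on $\mathcal W$ (its functor is lax symmetric monoidal, its unit $\eta$ and multiplication are monoidal transformations). Its Kleisli category $\mathrm{Kl}_M$ is symmetric monoidal, with the objects and coherence maps of $\mathcal W$, and $L:\mathcal W\to\mathrm{Kl}_M$, $f\mapsto f ⨟ \eta$, is strict symmetric monoidal. Let $\mathcal U$ be a class of objects of $\mathcal W$ (a full subcategory) that is a *strict monoidal subcategory of* $\mathrm{Kl}_M$: it contains $I$, is closed under $\otimes$, and for $A,B,C\in\mathcal U$ one has $(A\otimes B)\otimes C=A\otimes(B\otimes C)$ and $I\otimes A=A=A\otimes I$, the associators and unitors of $\mathrm{Kl}_M$ at these objects being identities. (This holds in particular if $\mathcal U$ is a full strict monoidal subcategory of $\mathcal W$.) The partial slice functor $\mathcal U/(-):\mathrm{Kl}_M\to\mathbf{cat}$ sends $A$ to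 the category whose objects are the pairs $(U,f)$ with $U\in\mathcal U$ and $f:U\to A$ in $\mathrm{Kl}_M$, and whose arrows $(U,f)\to(U',f')$ are the $\mathrm{Kl}_M$-arrows $\varphi:U\to U'$ with $f=\varphi ⨟ f'$; it acts on arrows by post-composition. It is lax monoidal, with unit $\mathrm{id}_I$ and comparison $(f,g)\mapsto f\otimes g$. A *monoidal $\mathcal V$-category* is a $\mathcal V$-category $\mathcal C$ with a $\mathcal V$-functor $\boxtimes:\mathcal C\otimes\mathcal C\to\mathcal C$, an object $J$ and $\mathcal V$-natural isomorphisms $a,l,r$ satisfying the pentagon and triangle identities; it is *symmetric* if it carries a $\mathcal V$-natural $s_{X,Y}: X\boxtimes Y\to Y\boxtimes X$ satisfying the axioms of a symmetric monoidal category. A *nearly strict monoidal 2-category* is a (strict) 2-category $\mathbb C$ with a pseudofunctor $\boxtimes:\mathbb C\times\mathbb C\to\mathbb C$, an object $J$ and strictly 2-natural, strictly invertible 1-cells $a_{X,Y,Z}:(X\boxtimes Y)\boxtimes Z\to X\boxtimes(Y\boxtimes Z)$, $l_X:J\boxtimes X\to X$, $r_X:X\boxtimes J\to X$ that satisfy the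 pentagon and triangle identities on the nose. The composition 2-cells $\vartheta:(f_1\boxtimes f_2)⨟(g_1\boxtimes g_2)\Rightarrow(f_1⨟ g_1)\boxtimes(f_2⨟ g_2)$ of $\boxtimes$ are called tensorators. It is *symmetric* if it is equipped with a strong 2-natural transformation with 1-cell components $s_{X,Y}:X\boxtimes Y\to Y\boxtimes X$ that satisfy $s_{X,Y}⨟ s_{Y,X}=\mathrm{id}$, the hexagon identity and $s_{X,J}⨟ l_X=r_X$ on the nose. **Theorem.** For every $\mathcal V$-category $\mathcal C$, change of base along $$\mathcal V\xrightarrow{F}\mathcal W\xrightarrow{L}\mathrm{Kl}_M\xrightarrow{\mathcal U/(-)}\mathbf{cat}$$ gives a strict 2-category $(\mathcal U/MF)_*\mathcal C$, described as follows. 1. The 0-cells are the objects of $\mathcal C$. 2. The 1-cells $X\to Y$ are the pairs of an object $U\in\mathcal U$ and a $\mathrm{Kl}_M$-arrow $f:U\to F\mathcal C(X,Y)$. 3. The 2-cells from $f:U\to F\mathcal C(X,Y)$ to $g:U'\to F\mathcal C(X,Y)$ are the $\mathrm{Kl}_M$-arrows $\varphi:U\to U'$ with $f=\varphi⨟ g$.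 Their vertical composition and identities are those of $\mathrm{Kl}_M$. 4. The horizontal composite of $f:U_1\to F\mathcal C(X,Y)$ and $g:U_2\to F\mathcal C(Y,Z)$ is $(f\otimes g)⨟ L(\tilde F⨟ F(\circ_{\mathcal C})):U_1\otimes U_2\to F\mathcal C(X,Z)$, where $\circ_{\mathcal C}:\mathcal C(X,Y)\otimes\mathcal C(Y,Z)\to\mathcal C(X,Z)$ is the composition of $\mathcal C$; that of 2-cells $\varphi,\psi$ is $\varphi\otimes\psi$. The identity 1-cell of $X$ is $L(F_\varepsilon⨟ F(\mathrm{id}_X)):I\to F\mathcal C(X,X)$. 5. If $\mathcal C$ is a monoidal $\mathcal V$-category, then $(\mathcal U/MF)_*\mathcal C$ is a nearly strict monoidal 2-category with unit object $J$, whose product is $\boxtimes$ on 0-cells, sends 1-cells $f_i:U_i\to F\mathcal C(X_i,Y_i)$ to $(f_1\otimes f_2)⨟ L(\tilde F⨟ F(\boxtimes_{\mathcal C})):U_1\otimes U_2\to F\mathcal C(X_1\boxtimes X_2,Y_1\boxtimes Y_2)$ and 2-cells $\varphi_1,\varphi_2$ to $\varphi_1\otimes\varphi_2$. It preserves identity 1-cells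 strictly. For $f_i$ with parameter space $U_i$ and $g_i$ with parameter space $P_i$ the tensorator is the permutation of the two middle factors $$(U_1\otimes U_2)\otimes(P_1\otimes P_2)\to(U_1\otimes P_1)\otimes(U_2\otimes P_2).$$ The coherence 1-cells are $L(F_\varepsilon⨟ F(a_{X,Y,Z}))$, $L(F_\varepsilon⨟ F(l_X))$ and $L(F_\varepsilon⨟ F(r_X))$, with parameter space $I$. 6. If moreover $\mathcal C$ is symmetric with symmetry $s$, then this nearly strict monoidal 2-category is symmetric, with 1-cells $L(F_\varepsilon⨟ F(s_{X,Y})):I\to F\mathcal C(X\boxtimes Y,Y\boxtimes X)$. Its naturality 2-cell $(f_1\boxtimes f_2)⨟ s_{Y_1,Y_2}\Rightarrow s_{X_1,X_2}⨟(f_2\boxtimes f_1)$ is the swap $U_1\otimes U_2\to U_2\otimes U_1$ of the parameter spaces (where $U_1\otimes U_2\otimes I=U_1\otimes U_2$ and $I\otimes U_2\otimes U_1=U_2\otimes U_1$). -/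

import Mathlib

-- Lean otherwise reads the arrows of a category through its underlying reflexive quiver.
attribute [-instance] CategoryTheory.catToReflQuiver

universe w₁ w₂ w₃ w₄ v₁ v₂ v₃ v₄ u₁ u₂ u₃ u₄

open CategoryTheory

namespace ParamUncertainty

/-! ### Nearly strict (symmetric) monoidal 2-categories -/

section NearlyStrict

open Bicategory

section Products

variable {A : Type u₁} [Bicategory.{w₁, v₁} A] {A' : Type u₂} [Bicategory.{w₂, v₂} A']
  {B : Type u₃} [Bicategory.{w₃, v₃} B] {B' : Type u₄} [Bicategory.{w₄, v₄} B']

/-- The product `F × G` of two pseudofunctors. -/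
def prodMap (F : Pseudofunctor A A') (G : Pseudofunctor B B') :
    Pseudofunctor (A × B) (A' × B') where
  obj X := (F.obj X.1, G.obj X.2)
  map f := Prod.mkHom (F.map f.1) (G.map f.2)
  map₂ η := Prod.mkHom (F.map₂ η.1) (G.map₂ η.2)
  mapId X := Iso.prod (F.mapId X.1) (G.mapId X.2)
  mapComp f g := Iso.prod (F.mapComp f.1 g.1) (G.mapComp f.2 g.2)

/-- The strict 2-functor `(A × A') × B ⥤ A × (A' × B)`. -/
def prodAssoc (A : Type u₁) [Bicategory.{w₁, v₁} A] (A' : Type u₂) [Bicategory.{w₂, v₂} A']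
    (B : Type u₃) [Bicategory.{w₃, v₃} B] :
    StrictPseudofunctor ((A × A') × B) (A × (A' × B)) := .mk'
  { obj X := (X.1.1, (X.1.2, X.2))
    map f := Prod.mkHom f.1.1 (Prod.mkHom f.1.2 f.2)
    map₂ η := Prod.mkHom η.1.1 (Prod.mkHom η.1.2 η.2) }

end Products

variable {B : Type u₁} [Bicategory.{w₁, v₁} B]

/-- The data and axioms that turn a given action `F` on 0-, 1- and 2-cells (functorial on 2-cells
for vertical composition) into a pseudofunctor. -/
structure PseudoStructure {B' : Type u₂} [Bicategory.{w₂, v₂} B'] (F : PrelaxFunctor B B') where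
  mapId (a : B) : F.map (𝟙 a) ≅ 𝟙 (F.obj a)
  mapComp {a b c : B} (f : a ⟶ b) (g : b ⟶ c) : F.map (f ≫ g) ≅ F.map f ≫ F.map g
  map₂_whiskerLeft {a b c : B} (f : a ⟶ b) {g h : b ⟶ c} (η : g ⟶ h) :
    F.map₂ (f ◁ η) = (mapComp f g).hom ≫ F.map f ◁ F.map₂ η ≫ (mapComp f h).inv
  map₂_whiskerRight {a b c : B} {f g : a ⟶ b} (η : f ⟶ g) (h : b ⟶ c) :
    F.map₂ (η ▷ h) = (mapComp f h).hom ≫ F.map₂ η ▷ F.map h ≫ (mapComp g h).inv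
  map₂_associator {a b c d : B} (f : a ⟶ b) (g : b ⟶ c) (h : c ⟶ d) :
    F.map₂ (α_ f g h).hom = (mapComp (f ≫ g) h).hom ≫ (mapComp f g).hom ▷ F.map h ≫
      (α_ (F.map f) (F.map g) (F.map h)).hom ≫ F.map f ◁ (mapComp g h).inv ≫
        (mapComp f (g ≫ h)).inv
  map₂_leftUnitor {a b : B} (f : a ⟶ b) :
    F.map₂ (λ_ f).hom = (mapComp (𝟙 a) f).hom ≫ (mapId a).hom ▷ F.map f ≫ (λ_ (F.map f)).hom
  map₂_rightUnitor {a b : B} (f : a ⟶ b) :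
    F.map₂ (ρ_ f).hom = (mapComp f (𝟙 b)).hom ≫ F.map f ◁ (mapId b).hom ≫ (ρ_ (F.map f)).hom

/-- The pseudofunctor given by a `PseudoStructure`. -/
def PseudoStructure.toPseudofunctor {B' : Type u₂} [Bicategory.{w₂, v₂} B']
    {F : PrelaxFunctor B B'} (S : PseudoStructure F) : Pseudofunctor B B' where
  toPrelaxFunctor := F
  mapId := S.mapId
  mapComp := S.mapComp
  map₂_whisker_left := S.map₂_whiskerLeft
  map₂_whisker_right := S.map₂_whiskerRight
  map₂_associator := S.map₂_associator
  map₂_left_unitor := S.map₂_leftUnitor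
  map₂_right_unitor := S.map₂_rightUnitor

/-- The 2-cell `η : f ⟶ g` is an identity (so that in particular `f = g`). -/
def IsIdentityCell {X Y : B} {f g : X ⟶ Y} (η : f ⟶ g) : Prop := ∃ h : f = g, η = eqToHom h

/-- The 1-cell `f` is (strictly) invertible. -/
def IsInvertible {X Y : B} (f : X ⟶ Y) : Prop := ∃ g : Y ⟶ X, f ≫ g = 𝟙 X ∧ g ≫ f = 𝟙 Y

/-- A strict 2-natural transformation: all naturality 2-cells are identities. -/
def IsStrictTrans {B' : Type u₂} [Bicategory.{w₂, v₂} B'] {F G : Pseudofunctor B B'}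
    (τ : Pseudofunctor.StrongTrans F G) : Prop :=
  ∀ ⦃X Y : B⦄ (f : X ⟶ Y), IsIdentityCell (τ.naturality f).hom

section

variable (T : Pseudofunctor (B × B) B) (J : B)

/-- `((X, Y), Z) ↦ (X ⊠ Y) ⊠ Z`. -/
def tensorLeft : Pseudofunctor ((B × B) × B) B :=
  (prodMap T (Pseudofunctor.id B)).comp T

/-- `((X, Y), Z) ↦ X ⊠ (Y ⊠ Z)`. -/
def tensorRight : Pseudofunctor ((B × B) × B) B :=
  (prodAssoc B B B).toPseudofunctor.comp ((prodMap (Pseudofunctor.id B) T).comp T)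

/-- `X ↦ J ⊠ X`. -/
def unitTensor : Pseudofunctor B B := (Bicategory.Prod.sectR J B).toPseudofunctor.comp T

/-- `X ↦ X ⊠ J`. -/
def tensorUnit : Pseudofunctor B B := (Bicategory.Prod.sectL B J).toPseudofunctor.comp T

/-- `(X, Y) ↦ Y ⊠ X`. -/
def tensorSwap : Pseudofunctor (B × B) B := (Bicategory.Prod.swap B B).toPseudofunctor.comp T

/-- The product `f ⊠ g` of two 1-cells. -/
abbrev tensor₁ {X₁ Y₁ X₂ Y₂ : B} (f : X₁ ⟶ Y₁) (g : X₂ ⟶ Y₂) :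
    T.obj (X₁, X₂) ⟶ T.obj (Y₁, Y₂) := T.map (Prod.mkHom f g)

/-- A nearly strict monoidal structure on the (strict) 2-category `B` with monoidal product the
pseudofunctor `T` and unit object `J`: strictly invertible, strictly 2-natural coherence 1-cells
`a`, `l`, `r` that satisfy the pentagon and the triangle identity on the nose. The tensorators
`(f₁ ⊠ f₂) ≫ (g₁ ⊠ g₂) ⟶ (f₁ ≫ g₁) ⊠ (f₂ ≫ g₂)` are the 2-cells `(T.mapComp _ _).inv`. -/
structure NearlyStrictMonoidal [Strict B] where
  a : Pseudofunctor.StrongTrans (tensorLeft T) (tensorRight T)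
  a_strict : IsStrictTrans a
  a_invertible (X : (B × B) × B) : IsInvertible (a.app X)
  l : Pseudofunctor.StrongTrans (unitTensor T J) (Pseudofunctor.id B)
  l_strict : IsStrictTrans l
  l_invertible (X : B) : IsInvertible (l.app X)
  r : Pseudofunctor.StrongTrans (tensorUnit T J) (Pseudofunctor.id B)
  r_strict : IsStrictTrans r
  r_invertible (X : B) : IsInvertible (r.app X)
  pentagon (W X Y Z : B) :
    tensor₁ T (a.app ((W, X), Y)) (𝟙 Z) ≫ a.app ((W, T.obj (X, Y)), Z) ≫
        tensor₁ T (𝟙 W) (a.app ((X, Y), Z)) =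
      a.app ((T.obj (W, X), Y), Z) ≫ a.app ((W, X), T.obj (Y, Z))
  triangle (X Y : B) :
    a.app ((X, J), Y) ≫ tensor₁ T (𝟙 X) (l.app Y) = tensor₁ T (r.app X) (𝟙 Y)

variable {T J}

/-- A symmetry on a nearly strict monoidal 2-category: a strong 2-natural transformation
`s : X ⊠ Y ⟶ Y ⊠ X` whose 1-cell components satisfy the axioms of a symmetric monoidal category
on the nose. -/
structure NearlyStrictSymmetric [Strict B] (N : NearlyStrictMonoidal T J) where
  s : Pseudofunctor.StrongTrans T (tensorSwap T)
  s_s (X Y : B) : s.app (X, Y) ≫ s.app (Y, X) = 𝟙 (T.obj (X, Y))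
  hexagon (X Y Z : B) :
    tensor₁ T (s.app (X, Y)) (𝟙 Z) ≫ N.a.app ((Y, X), Z) ≫ tensor₁ T (𝟙 Y) (s.app (X, Z)) =
      N.a.app ((X, Y), Z) ≫ s.app (X, T.obj (Y, Z)) ≫ N.a.app ((Y, Z), X)
  unit (X : B) : s.app (X, J) ≫ N.l.app X = N.r.app X

end

end NearlyStrict

open MonoidalCategory Functor.LaxMonoidal

/-! ### (Symmetric) monoidal enriched categories -/

section Enriched

variable (V : Type u₁) [Category.{v₁} V] [MonoidalCategory V] [SymmetricCategory V]
  {C : Type u₂} [EnrichedCategory V C]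

variable {V} in
/-- Composition of a global element `I ⟶ C(X, Y)` with a generalized element `S ⟶ C(Y, Z)`. -/
def elemComp {S : V} {X Y Z : C} (x : 𝟙_ V ⟶ (X ⟶[V] Y)) (y : S ⟶ (Y ⟶[V] Z)) :
    S ⟶ (X ⟶[V] Z) :=
  (λ_ S).inv ≫ (x ⊗ₘ y) ≫ eComp V X Y Z

variable {V} in
/-- Composition of a generalized element `S ⟶ C(X, Y)` with a global element `I ⟶ C(Y, Z)`. -/
def compElem {S : V} {X Y Z : C} (y : S ⟶ (X ⟶[V] Y)) (x : 𝟙_ V ⟶ (Y ⟶[V] Z)) :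
    S ⟶ (X ⟶[V] Z) :=
  (ρ_ S).inv ≫ (y ⊗ₘ x) ≫ eComp V X Y Z

variable (C) in
/-- A monoidal `V`-category: a `V`-category `C` with a `V`-functor `⊠ : C ⊗ C ⟶ C`, where
`(C ⊗ C)((X₁, X₂), (Y₁, Y₂)) = C(X₁, Y₁) ⊗ C(X₂, Y₂)`, a unit object `J` and `V`-natural
isomorphisms `a`, `l`, `r` that satisfy the pentagon and triangle identities in the underlying
category of `C`. -/
structure MonoidalEnrichedCategory where
  obj : C → C → C
  hom (X₁ Y₁ X₂ Y₂ : C) : (X₁ ⟶[V] Y₁) ⊗ (X₂ ⟶[V] Y₂) ⟶ (obj X₁ X₂ ⟶[V] obj Y₁ Y₂)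
  hom_id (X₁ X₂ : C) :
    (λ_ (𝟙_ V)).inv ≫ (eId V X₁ ⊗ₘ eId V X₂) ≫ hom X₁ X₁ X₂ X₂ = eId V (obj X₁ X₂)
  hom_comp (X₁ Y₁ Z₁ X₂ Y₂ Z₂ : C) :
    tensorμ (X₁ ⟶[V] Y₁) (X₂ ⟶[V] Y₂) (Y₁ ⟶[V] Z₁) (Y₂ ⟶[V] Z₂) ≫
        (eComp V X₁ Y₁ Z₁ ⊗ₘ eComp V X₂ Y₂ Z₂) ≫ hom X₁ Z₁ X₂ Z₂ =
      (hom X₁ Y₁ X₂ Y₂ ⊗ₘ hom Y₁ Z₁ Y₂ Z₂) ≫ eComp V (obj X₁ X₂) (obj Y₁ Y₂) (obj Z₁ Z₂)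
  J : C
  a (X Y Z : C) : 𝟙_ V ⟶ (obj (obj X Y) Z ⟶[V] obj X (obj Y Z))
  aInv (X Y Z : C) : 𝟙_ V ⟶ (obj X (obj Y Z) ⟶[V] obj (obj X Y) Z)
  a_aInv (X Y Z : C) : elemComp (a X Y Z) (aInv X Y Z) = eId V (obj (obj X Y) Z)
  aInv_a (X Y Z : C) : elemComp (aInv X Y Z) (a X Y Z) = eId V (obj X (obj Y Z))
  a_natural (X Y Z X' Y' Z' : C) :
    compElem ((hom X X' Y Y' ▷ (Z ⟶[V] Z')) ≫ hom (obj X Y) (obj X' Y') Z Z') (a X' Y' Z') =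
      elemComp (a X Y Z) ((α_ (X ⟶[V] X') (Y ⟶[V] Y') (Z ⟶[V] Z')).hom ≫
        ((X ⟶[V] X') ◁ hom Y Y' Z Z') ≫ hom X X' (obj Y Z) (obj Y' Z'))
  l (X : C) : 𝟙_ V ⟶ (obj J X ⟶[V] X)
  lInv (X : C) : 𝟙_ V ⟶ (X ⟶[V] obj J X)
  l_lInv (X : C) : elemComp (l X) (lInv X) = eId V (obj J X)
  lInv_l (X : C) : elemComp (lInv X) (l X) = eId V X
  l_natural (X X' : C) :
    compElem ((λ_ (X ⟶[V] X')).inv ≫ (eId V J ▷ (X ⟶[V] X')) ≫ hom J J X X') (l X') =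
      elemComp (l X) (𝟙 (X ⟶[V] X'))
  r (X : C) : 𝟙_ V ⟶ (obj X J ⟶[V] X)
  rInv (X : C) : 𝟙_ V ⟶ (X ⟶[V] obj X J)
  r_rInv (X : C) : elemComp (r X) (rInv X) = eId V (obj X J)
  rInv_r (X : C) : elemComp (rInv X) (r X) = eId V X
  r_natural (X X' : C) :
    compElem ((ρ_ (X ⟶[V] X')).inv ≫ ((X ⟶[V] X') ◁ eId V J) ≫ hom X X' J J) (r X') =
      elemComp (r X) (𝟙 (X ⟶[V] X'))
  pentagon (W X Y Z : C) :
    elemComp ((λ_ (𝟙_ V)).inv ≫ (a W X Y ⊗ₘ eId V Z) ≫ hom _ _ _ _)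
        (elemComp (a W (obj X Y) Z)
          ((λ_ (𝟙_ V)).inv ≫ (eId V W ⊗ₘ a X Y Z) ≫ hom _ _ _ _)) =
      elemComp (a (obj W X) Y Z) (a W X (obj Y Z))
  triangle (X Y : C) :
    elemComp (a X J Y) ((λ_ (𝟙_ V)).inv ≫ (eId V X ⊗ₘ l Y) ≫ hom _ _ _ _) =
      (λ_ (𝟙_ V)).inv ≫ (r X ⊗ₘ eId V Y) ≫ hom _ _ _ _

variable {V} in
/-- A symmetry on a monoidal `V`-category: a `V`-natural transformation `s` that satisfies the
axioms of a symmetric monoidal category in the underlying category. -/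
structure SymmetricEnrichedCategory (T : MonoidalEnrichedCategory V C) where
  s (X Y : C) : 𝟙_ V ⟶ (T.obj X Y ⟶[V] T.obj Y X)
  s_natural (X Y X' Y' : C) :
    compElem (T.hom X X' Y Y') (s X' Y') =
      elemComp (s X Y) ((β_ (X ⟶[V] X') (Y ⟶[V] Y')).hom ≫ T.hom Y Y' X X')
  s_s (X Y : C) : elemComp (s X Y) (s Y X) = eId V (T.obj X Y)
  hexagon (X Y Z : C) :
    elemComp ((λ_ (𝟙_ V)).inv ≫ (s X Y ⊗ₘ eId V Z) ≫ T.hom _ _ _ _)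
        (elemComp (T.a Y X Z) ((λ_ (𝟙_ V)).inv ≫ (eId V Y ⊗ₘ s X Z) ≫ T.hom _ _ _ _)) =
      elemComp (T.a X Y Z) (elemComp (s X (T.obj Y Z)) (T.a Y Z X))
  unit (X : C) : elemComp (s X T.J) (T.l X) = T.r X

end Enriched

/-! ### The partial slice functor -/

/-- The full subcategory of `K` on the objects that satisfy `P` is a strict monoidal subcategory:
it contains the unit, is closed under `⊗`, and the associators and unitors of its objects are
identities. -/
class IsStrictMonoidalSubcategory {K : Type u₁} [Category.{v₁} K] [MonoidalCategory K]
    (P : ObjectProperty K) : Prop extends P.IsMonoidal where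
  associator : ∀ {A B C : K}, P A → P B → P C →
    ∃ h : (A ⊗ B) ⊗ C = A ⊗ (B ⊗ C), (α_ A B C).hom = eqToHom h
  leftUnitor : ∀ {A : K}, P A → ∃ h : 𝟙_ K ⊗ A = A, (λ_ A).hom = eqToHom h
  rightUnitor : ∀ {A : K}, P A → ∃ h : A ⊗ 𝟙_ K = A, (ρ_ A).hom = eqToHom h

namespace PartialSlice

variable {K : Type u₁} [Category.{v₁} K] [MonoidalCategory K] (P : ObjectProperty K)

/-- The partial slice functor `P/(-)`, where `P` also denotes the full subcategory on the objects
that satisfy `P`: it sends `A` to the comma category of pairs `(U, f : U ⟶ A)` with `U` in `P`. -/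
abbrev functor : K ⥤ Cat.{v₁, max u₁ v₁} := CostructuredArrow.functor P.ι

variable {P}

theorem obj_eq {A : K} {f g : CostructuredArrow P.ι A} (h : f.left.obj = g.left.obj)
    (w : f.hom = eqToHom h ≫ g.hom) : f = g := by
  obtain ⟨⟨X, hX⟩, ⟨⟨⟩⟩, f⟩ := f
  obtain ⟨⟨Y, hY⟩, ⟨⟨⟩⟩, g⟩ := g
  dsimp at h
  subst h
  have : f = g := w.trans (Category.id_comp _)
  subst this
  rfl

/-- The map `U ⟶ U'` underlying an arrow from `U ⟶ A` to `U' ⟶ A`. -/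
def leftHom {A : K} {f g : CostructuredArrow P.ι A} (φ : f ⟶ g) : f.left.obj ⟶ g.left.obj :=
  φ.left.hom

theorem eqToHom_left_hom {A : K} {f g : CostructuredArrow P.ι A} (h : f = g) :
    (eqToHom h).left.hom = eqToHom (by rw [h]) := by
  subst h; rfl

theorem functor_eq {A : K} {D : Type*} [Category* D] {F G : D ⥤ CostructuredArrow P.ι A}
    (h : ∀ X, (F.obj X).left.obj = (G.obj X).left.obj)
    (w : ∀ X, (F.obj X).hom = eqToHom (h X) ≫ (G.obj X).hom)
    (m : ∀ {X Y} (f : X ⟶ Y), (F.map f).left.hom =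
      eqToHom (h X) ≫ (G.map f).left.hom ≫ eqToHom (h Y).symm) : F = G := by
  refine CategoryTheory.Functor.ext (fun X => obj_eq (h X) (w X)) (fun X Y f => ?_)
  apply CostructuredArrow.hom_ext
  apply InducedCategory.hom_ext
  refine (m f).trans ?_
  simp only [CostructuredArrow.comp_left, ObjectProperty.FullSubcategory.comp_hom,
    eqToHom_left_hom]

variable [IsStrictMonoidalSubcategory P]

/-- The object `f : U ⟶ A` of the partial slice over `A`. -/
def mkObj {A : K} (U : K) (hU : P U) (f : U ⟶ A) : CostructuredArrow P.ι A :=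
  CostructuredArrow.mk (S := P.ι) (Y := (⟨U, hU⟩ : P.FullSubcategory)) f

/-- `(f, g) ↦ f ⊗ g` on objects and on arrows. -/
def tensor (A B : K) :
    CostructuredArrow P.ι A × CostructuredArrow P.ι B ⥤ CostructuredArrow P.ι (A ⊗ B) where
  obj f := mkObj (f.1.left.obj ⊗ f.2.left.obj)
    (ObjectProperty.prop_tensor f.1.left.property f.2.left.property) (f.1.hom ⊗ₘ f.2.hom)
  map φ := CostructuredArrow.homMk (ObjectProperty.homMk (φ.1.left.hom ⊗ₘ φ.2.left.hom)) (by
    refine (tensorHom_comp_tensorHom φ.1.left.hom φ.2.left.hom _ _).trans ?_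
    exact congrArg₂ (· ⊗ₘ ·) (CostructuredArrow.w φ.1) (CostructuredArrow.w φ.2))
  map_id f := CostructuredArrow.hom_ext _ _ (InducedCategory.hom_ext (id_tensorHom_id _ _))
  map_comp φ ψ := CostructuredArrow.hom_ext _ _
    (InducedCategory.hom_ext (tensorHom_comp_tensorHom _ _ _ _).symm)

/-- The partial slice functor is lax monoidal, with unit `𝟙 (𝟙_ K)` and comparison `(f, g) ↦ f ⊗ g`. -/
instance : (functor P).LaxMonoidal where
  ε := (Cat.fromChosenTerminalEquiv.symm (mkObj (𝟙_ K) P.prop_unit (𝟙 (𝟙_ K)))).toCatHom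
  μ A B := (tensor A B).toCatHom
  μ_natural_left {A B} f C := by
    apply Cat.Hom.ext
    change (CostructuredArrow.map f).prod (𝟭 _) ⋙ tensor B C =
      tensor A C ⋙ CostructuredArrow.map (f ▷ C)
    refine functor_eq (fun X => rfl) (fun X => ?_) (fun φ => ?_)
    · refine Eq.trans ?_ (Category.id_comp _).symm
      change (X.1.hom ≫ f) ⊗ₘ X.2.hom = (X.1.hom ⊗ₘ X.2.hom) ≫ (f ▷ C)
      rw [← tensorHom_id, tensorHom_comp_tensorHom, Category.comp_id]
    · exact ((Category.id_comp _).trans (Category.comp_id _)).symm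
  μ_natural_right {A B} C f := by
    apply Cat.Hom.ext
    change (𝟭 _).prod (CostructuredArrow.map f) ⋙ tensor C B =
      tensor C A ⋙ CostructuredArrow.map (C ◁ f)
    refine functor_eq (fun X => rfl) (fun X => ?_) (fun φ => ?_)
    · refine Eq.trans ?_ (Category.id_comp _).symm
      change X.1.hom ⊗ₘ (X.2.hom ≫ f) = (X.1.hom ⊗ₘ X.2.hom) ≫ (C ◁ f)
      rw [← id_tensorHom, tensorHom_comp_tensorHom, Category.comp_id]
    · exact ((Category.id_comp _).trans (Category.comp_id _)).symm
  associativity A B C := by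
    apply Cat.Hom.ext
    have hs (X : (CostructuredArrow P.ι A × CostructuredArrow P.ι B) × CostructuredArrow P.ι C) :=
      IsStrictMonoidalSubcategory.associator (P := P) X.1.1.left.property X.1.2.left.property
        X.2.left.property
    refine functor_eq (fun X => (hs X).1) (fun X => ?_) (fun {X Y} φ => ?_)
    · change ((X.1.1.hom ⊗ₘ X.1.2.hom) ⊗ₘ X.2.hom) ≫ (α_ A B C).hom =
        eqToHom (hs X).1 ≫ (X.1.1.hom ⊗ₘ (X.1.2.hom ⊗ₘ X.2.hom))
      rw [← (hs X).2, associator_naturality]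
      rfl
    · change (φ.1.1.left.hom ⊗ₘ φ.1.2.left.hom) ⊗ₘ φ.2.left.hom =
        eqToHom (hs X).1 ≫ (φ.1.1.left.hom ⊗ₘ (φ.1.2.left.hom ⊗ₘ φ.2.left.hom)) ≫
          eqToHom (hs Y).1.symm
      rw [← Category.assoc, ← (hs X).2, ← associator_naturality, (hs Y).2, Category.assoc,
        eqToHom_trans, eqToHom_refl, Category.comp_id]
  left_unitality A := by
    apply Cat.Hom.ext
    have hs (Z : CostructuredArrow P.ι A) :=
      IsStrictMonoidalSubcategory.leftUnitor (P := P) Z.left.property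
    refine functor_eq (fun X => (hs X.2).1.symm) (fun X => ?_) (fun {X Y} φ => ?_)
    · change X.2.hom = eqToHom (hs X.2).1.symm ≫ (𝟙 (𝟙_ K) ⊗ₘ X.2.hom) ≫ (λ_ A).hom
      rw [id_tensorHom, leftUnitor_naturality, (hs X.2).2, eqToHom_trans_assoc, eqToHom_refl]
      exact (Category.id_comp _).symm
    · change φ.2.left.hom = eqToHom (hs X.2).1.symm ≫ (𝟙 (𝟙_ K) ⊗ₘ φ.2.left.hom) ≫
        eqToHom (hs Y.2).1
      rw [id_tensorHom, ← (hs Y.2).2, leftUnitor_naturality, (hs X.2).2, eqToHom_trans_assoc,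
        eqToHom_refl, Category.id_comp]
  right_unitality A := by
    apply Cat.Hom.ext
    have hs (Z : CostructuredArrow P.ι A) :=
      IsStrictMonoidalSubcategory.rightUnitor (P := P) Z.left.property
    refine functor_eq (fun X => (hs X.1).1.symm) (fun X => ?_) (fun {X Y} φ => ?_)
    · change X.1.hom = eqToHom (hs X.1).1.symm ≫ (X.1.hom ⊗ₘ 𝟙 (𝟙_ K)) ≫ (ρ_ A).hom
      rw [tensorHom_id, rightUnitor_naturality, (hs X.1).2, eqToHom_trans_assoc, eqToHom_refl]
      exact (Category.id_comp _).symm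
    · change φ.1.left.hom = eqToHom (hs X.1).1.symm ≫ (φ.1.left.hom ⊗ₘ 𝟙 (𝟙_ K)) ≫
        eqToHom (hs Y.1).1
      rw [tensorHom_id, ← (hs Y.1).2, rightUnitor_naturality, (hs X.1).2, eqToHom_trans_assoc,
        eqToHom_refl, Category.id_comp]

end PartialSlice

/-! ### Symmetric monoidal monads and their Kleisli categories -/

/-- A symmetric monoidal monad: the functor `M` is lax symmetric monoidal, and `η` and `μ` are
monoidal transformations (in particular the unit comparison of `M` is `η` at the unit). -/
class SymmetricMonoidalMonad {W : Type u₂} [Category.{v₂} W] [MonoidalCategory W]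
    [SymmetricCategory W] (M : Monad W) extends M.toFunctor.LaxBraided where
  isMonoidal_η : NatTrans.IsMonoidal M.η
  isMonoidal_μ : NatTrans.IsMonoidal M.μ

attribute [instance] SymmetricMonoidalMonad.isMonoidal_η SymmetricMonoidalMonad.isMonoidal_μ

section KleisliMonoidal

variable {W : Type u₂} [Category.{v₂} W] [MonoidalCategory W] [SymmetricCategory W]
  (M : Monad W) [SymmetricMonoidalMonad M]

theorem monad_ε_eq : ε M.toFunctor = M.η.app (𝟙_ W) := by
  simpa using (NatTrans.IsMonoidal.unit (τ := M.η)).symm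

theorem monadη_tensor (X Y : W) :
    (M.η.app X ⊗ₘ M.η.app Y) ≫ μ M.toFunctor X Y = M.η.app (X ⊗ Y) := by
  simpa using (NatTrans.IsMonoidal.tensor (τ := M.η) X Y).symm

theorem monadμ_tensor (X Y : W) :
    (M.μ.app X ⊗ₘ M.μ.app Y) ≫ μ M.toFunctor X Y =
      μ M.toFunctor (M.obj X) (M.obj Y) ≫ M.map (μ M.toFunctor X Y) ≫ M.μ.app (X ⊗ Y) := by
  simpa using (NatTrans.IsMonoidal.tensor (τ := M.μ) X Y).symm

/-- The Kleisli tensor of `f : A ⟶ M X` and `g : B ⟶ M Y` is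
`A ⊗ B ⟶ M X ⊗ M Y ⟶ M (X ⊗ Y)`. -/
def kleisliTensorHom {X₁ Y₁ X₂ Y₂ : Kleisli M} (f : X₁ ⟶ Y₁) (g : X₂ ⟶ Y₂) :
    (Kleisli.mk M (X₁.of ⊗ X₂.of)) ⟶ (Kleisli.mk M (Y₁.of ⊗ Y₂.of)) :=
  ⟨(f.of ⊗ₘ g.of) ≫ μ M.toFunctor _ _⟩

theorem kleisliTensorHom_comp {X₁ Y₁ Z₁ X₂ Y₂ Z₂ : Kleisli M} (f₁ : X₁ ⟶ Y₁) (f₂ : X₂ ⟶ Y₂)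
    (g₁ : Y₁ ⟶ Z₁) (g₂ : Y₂ ⟶ Z₂) :
    kleisliTensorHom M f₁ f₂ ≫ kleisliTensorHom M g₁ g₂ = kleisliTensorHom M (f₁ ≫ g₁) (f₂ ≫ g₂) := by
  ext
  simp only [kleisliTensorHom, Kleisli.category_comp_of, Category.assoc, CategoryTheory.Functor.map_comp,
    ← tensorHom_comp_tensorHom, monadμ_tensor, Functor.LaxMonoidal.μ_natural_assoc]

theorem comp_pure {X Y Z : W} (g : X ⟶ M.obj Y) (f : Y ⟶ Z) :
    g ≫ M.map (f ≫ M.η.app Z) ≫ M.μ.app Z = g ≫ M.map f := by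
  simp

theorem pure_comp {X Y Z : W} (f : X ⟶ Y) (g : Y ⟶ M.obj Z) :
    (f ≫ M.η.app Y) ≫ M.map g ≫ M.μ.app Z = f ≫ g := by
  have := M.η.naturality_assoc g (M.μ.app Z)
  simp only [Functor.id_map] at this
  rw [Category.assoc, ← this, Monad.left_unit]
  exact congrArg (f ≫ ·) (Category.comp_id g)

theorem pure_tensor {X₁ Y₁ X₂ Y₂ : W} (f : X₁ ⟶ Y₁) (g : X₂ ⟶ Y₂) :
    ((f ≫ M.η.app Y₁) ⊗ₘ (g ≫ M.η.app Y₂)) ≫ μ M.toFunctor Y₁ Y₂ =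
      (f ⊗ₘ g) ≫ M.η.app (Y₁ ⊗ Y₂) := by
  rw [← tensorHom_comp_tensorHom, Category.assoc, monadη_tensor]

theorem toKleisli_tensor {X₁ Y₁ X₂ Y₂ : W} (f : X₁ ⟶ Y₁) (g : X₂ ⟶ Y₂) :
    kleisliTensorHom M ((Kleisli.Adjunction.toKleisli M).map f) ((Kleisli.Adjunction.toKleisli M).map g) =
      (Kleisli.Adjunction.toKleisli M).map (f ⊗ₘ g) :=
  Kleisli.hom_ext (pure_tensor M f g)

theorem toKleisli_tensor_id {X Y : W} (f : X ⟶ Y) (Z : W) :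
    kleisliTensorHom M ((Kleisli.Adjunction.toKleisli M).map f) (𝟙 (Kleisli.mk M Z)) =
      (Kleisli.Adjunction.toKleisli M).map (f ▷ Z) := by
  rw [← tensorHom_id, ← toKleisli_tensor, CategoryTheory.Functor.map_id]
  rfl

theorem toKleisli_id_tensor {X Y : W} (f : X ⟶ Y) (Z : W) :
    kleisliTensorHom M (𝟙 (Kleisli.mk M Z)) ((Kleisli.Adjunction.toKleisli M).map f) =
      (Kleisli.Adjunction.toKleisli M).map (Z ◁ f) := by
  rw [← id_tensorHom, ← toKleisli_tensor, CategoryTheory.Functor.map_id]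
  rfl

/-- The monoidal structure of the Kleisli category; its coherence maps are the images of those of
`W`. -/
instance : MonoidalCategoryStruct (Kleisli M) where
  tensorObj X Y := Kleisli.mk M (X.of ⊗ Y.of)
  tensorHom f g := kleisliTensorHom M f g
  whiskerLeft X _ _ f := kleisliTensorHom M (𝟙 X) f
  whiskerRight f Y := kleisliTensorHom M f (𝟙 Y)
  tensorUnit := Kleisli.mk M (𝟙_ W)
  associator X Y Z := (Kleisli.Adjunction.toKleisli M).mapIso (α_ X.of Y.of Z.of)
  leftUnitor X := (Kleisli.Adjunction.toKleisli M).mapIso (λ_ X.of)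
  rightUnitor X := (Kleisli.Adjunction.toKleisli M).mapIso (ρ_ X.of)

instance : MonoidalCategory (Kleisli M) := by
  refine MonoidalCategory.ofTensorHom ?_ ?_ ?_ ?_ ?_ ?_ ?_ ?_ ?_
  · intro X Y
    apply Kleisli.hom_ext
    exact monadη_tensor M X.of Y.of
  · intros; rfl
  · intros; rfl
  · intros; exact kleisliTensorHom_comp M _ _ _ _
  · intro X₁ X₂ X₃ Y₁ Y₂ Y₃ f₁ f₂ f₃
    apply Kleisli.hom_ext
    refine (comp_pure M _ _).trans (Eq.trans ?_ (pure_comp M _ _).symm)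
    change ((((f₁.of ⊗ₘ f₂.of) ≫ μ M.toFunctor _ _) ⊗ₘ f₃.of) ≫ μ M.toFunctor _ _) ≫
        M.map (α_ Y₁.of Y₂.of Y₃.of).hom =
      (α_ X₁.of X₂.of X₃.of).hom ≫
        (f₁.of ⊗ₘ ((f₂.of ⊗ₘ f₃.of) ≫ μ M.toFunctor _ _)) ≫ μ M.toFunctor _ _
    have h1 : ((f₁.of ⊗ₘ f₂.of) ≫ μ M.toFunctor Y₁.of Y₂.of) ⊗ₘ f₃.of =
        ((f₁.of ⊗ₘ f₂.of) ⊗ₘ f₃.of) ≫ μ M.toFunctor Y₁.of Y₂.of ▷ _ := by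
      rw [← tensorHom_id, tensorHom_comp_tensorHom, Category.comp_id]
    have h2 : f₁.of ⊗ₘ ((f₂.of ⊗ₘ f₃.of) ≫ μ M.toFunctor Y₂.of Y₃.of) =
        (f₁.of ⊗ₘ (f₂.of ⊗ₘ f₃.of)) ≫ _ ◁ μ M.toFunctor Y₂.of Y₃.of := by
      rw [← id_tensorHom, tensorHom_comp_tensorHom, Category.comp_id]
    rw [h1, h2, Category.assoc, Category.assoc, Category.assoc,
      Functor.LaxMonoidal.associativity, associator_naturality_assoc]
  · intro X Y f
    apply Kleisli.hom_ext
    refine (comp_pure M _ _).trans (Eq.trans ?_ (pure_comp M _ _).symm)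
    change ((M.η.app (𝟙_ W) ⊗ₘ f.of) ≫ μ M.toFunctor _ _) ≫ M.map (λ_ Y.of).hom =
      (λ_ X.of).hom ≫ f.of
    rw [← monad_ε_eq, ← leftUnitor_naturality, Functor.LaxMonoidal.left_unitality,
      MonoidalCategory.tensorHom_def', Category.assoc, Category.assoc]
    rfl
  · intro X Y f
    apply Kleisli.hom_ext
    refine (comp_pure M _ _).trans (Eq.trans ?_ (pure_comp M _ _).symm)
    change ((f.of ⊗ₘ M.η.app (𝟙_ W)) ≫ μ M.toFunctor _ _) ≫ M.map (ρ_ Y.of).hom =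
      (ρ_ X.of).hom ≫ f.of
    rw [← monad_ε_eq, ← rightUnitor_naturality, Functor.LaxMonoidal.right_unitality,
      MonoidalCategory.tensorHom_def, Category.assoc, Category.assoc]
    rfl
  · intro A B C D
    have h := congrArg (Kleisli.Adjunction.toKleisli M).map (pentagon A.of B.of C.of D.of)
    simp only [Functor.map_comp, ← toKleisli_tensor_id, ← toKleisli_id_tensor] at h
    exact h
  · intro X Y
    have h := congrArg (Kleisli.Adjunction.toKleisli M).map (triangle X.of Y.of)
    simp only [Functor.map_comp, ← toKleisli_tensor_id, ← toKleisli_id_tensor] at h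
    exact h

instance : SymmetricCategory (Kleisli M) where
  braiding X Y := (Kleisli.Adjunction.toKleisli M).mapIso (β_ X.of Y.of)
  braiding_naturality_right X Y Z f := by
    apply Kleisli.hom_ext
    refine (comp_pure M _ _).trans (Eq.trans ?_ (pure_comp M _ _).symm)
    change ((M.η.app X.of ⊗ₘ f.of) ≫ μ M.toFunctor _ _) ≫ M.map (β_ X.of Z.of).hom =
      (β_ X.of Y.of).hom ≫ (f.of ⊗ₘ M.η.app X.of) ≫ μ M.toFunctor _ _
    rw [Category.assoc, Functor.LaxBraided.braided, BraidedCategory.braiding_naturality_assoc]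
    rfl
  braiding_naturality_left f Z := by
    apply Kleisli.hom_ext
    refine (comp_pure M _ _).trans (Eq.trans ?_ (pure_comp M _ _).symm)
    change ((f.of ⊗ₘ M.η.app Z.of) ≫ μ M.toFunctor _ _) ≫ M.map (β_ _ Z.of).hom =
      (β_ _ Z.of).hom ≫ (M.η.app Z.of ⊗ₘ f.of) ≫ μ M.toFunctor _ _
    rw [Category.assoc, Functor.LaxBraided.braided, BraidedCategory.braiding_naturality_assoc]
    rfl
  hexagon_forward X Y Z := by
    have h := congrArg (Kleisli.Adjunction.toKleisli M).map
      (BraidedCategory.hexagon_forward X.of Y.of Z.of)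
    simp only [Functor.map_comp, ← toKleisli_tensor_id, ← toKleisli_id_tensor] at h
    exact h
  hexagon_reverse X Y Z := by
    have h := congrArg (Kleisli.Adjunction.toKleisli M).map
      (BraidedCategory.hexagon_reverse X.of Y.of Z.of)
    simp only [Functor.map_comp, ← toKleisli_tensor_id, ← toKleisli_id_tensor] at h
    exact h
  symmetry X Y := by
    have h := congrArg (Kleisli.Adjunction.toKleisli M).map
      (SymmetricCategory.symmetry X.of Y.of)
    rw [CategoryTheory.Functor.map_comp, CategoryTheory.Functor.map_id] at h
    exact h

/-- The functor `L_M : W ⥤ Kl_M`, `f ↦ f ≫ η`, is strict symmetric monoidal. -/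
instance : (Kleisli.Adjunction.toKleisli M).LaxBraided where
  ε := 𝟙 (Kleisli.mk M (𝟙_ W))
  μ X Y := 𝟙 (Kleisli.mk M (X ⊗ Y))
  μ_natural_left f Z := (Category.comp_id _).trans
    ((toKleisli_tensor_id M f Z).trans (Category.id_comp _).symm)
  μ_natural_right Z f := (Category.comp_id _).trans
    ((toKleisli_id_tensor M f Z).trans (Category.id_comp _).symm)
  associativity X Y Z := by
    have h1 : 𝟙 (Kleisli.mk M (X ⊗ Y)) ▷ Kleisli.mk M Z = 𝟙 _ := id_whiskerRight _ _
    have h2 : Kleisli.mk M X ◁ 𝟙 (Kleisli.mk M (Y ⊗ Z)) = 𝟙 _ := whiskerLeft_id _ _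
    have h : (𝟙 (Kleisli.mk M (X ⊗ Y)) ▷ Kleisli.mk M Z) ≫ 𝟙 (Kleisli.mk M ((X ⊗ Y) ⊗ Z)) ≫
        (Kleisli.Adjunction.toKleisli M).map (α_ X Y Z).hom =
      (α_ (Kleisli.mk M X) (Kleisli.mk M Y) (Kleisli.mk M Z)).hom ≫
        (Kleisli.mk M X ◁ 𝟙 (Kleisli.mk M (Y ⊗ Z))) ≫ 𝟙 (Kleisli.mk M (X ⊗ Y ⊗ Z)) := by
      rw [h1, h2]
      exact (Category.id_comp _).trans ((Category.id_comp _).trans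
        ((congrArg (fun t => (α_ (Kleisli.mk M X) (Kleisli.mk M Y) (Kleisli.mk M Z)).hom ≫ t)
          (Category.comp_id _)).trans (Category.comp_id _)).symm)
    exact h
  left_unitality X := by
    have h1 : 𝟙 (Kleisli.mk M (𝟙_ W)) ▷ Kleisli.mk M X = 𝟙 _ := id_whiskerRight _ _
    have h : (λ_ (Kleisli.mk M X)).hom = (𝟙 (Kleisli.mk M (𝟙_ W)) ▷ Kleisli.mk M X) ≫
        𝟙 (Kleisli.mk M (𝟙_ W ⊗ X)) ≫ (Kleisli.Adjunction.toKleisli M).map (λ_ X).hom := by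
      rw [h1]
      exact ((Category.id_comp _).trans (Category.id_comp _)).symm
    exact h
  right_unitality X := by
    have h1 : Kleisli.mk M X ◁ 𝟙 (Kleisli.mk M (𝟙_ W)) = 𝟙 _ := whiskerLeft_id _ _
    have h : (ρ_ (Kleisli.mk M X)).hom = (Kleisli.mk M X ◁ 𝟙 (Kleisli.mk M (𝟙_ W))) ≫
        𝟙 (Kleisli.mk M (X ⊗ 𝟙_ W)) ≫ (Kleisli.Adjunction.toKleisli M).map (ρ_ X).hom := by
      rw [h1]
      exact ((Category.id_comp _).trans (Category.id_comp _)).symm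
    exact h
  braided X Y := (Category.id_comp _).trans (Category.comp_id _).symm

/-- The objects of `Kl_M` that lie in `𝒰`. -/
def kleisliObjects (𝒰 : ObjectProperty W) : ObjectProperty (Kleisli M) := fun X => 𝒰 X.of

/-- A strict full monoidal subcategory of `W` is also strict as a full subcategory of `Kl_M`. -/
instance (𝒰 : ObjectProperty W) [IsStrictMonoidalSubcategory 𝒰] :
    IsStrictMonoidalSubcategory (kleisliObjects M 𝒰) where
  prop_unit := 𝒰.prop_unit
  prop_tensor _ _ h₁ h₂ := ObjectProperty.prop_tensor (Q := 𝒰) h₁ h₂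
  associator {A B D} hA hB hD := by
    obtain ⟨h, e⟩ := IsStrictMonoidalSubcategory.associator (P := 𝒰) hA hB hD
    exact ⟨congrArg (Kleisli.mk M) h, (congrArg (Kleisli.Adjunction.toKleisli M).map e).trans
      (eqToHom_map (Kleisli.Adjunction.toKleisli M) h)⟩
  leftUnitor {A} hA := by
    obtain ⟨h, e⟩ := IsStrictMonoidalSubcategory.leftUnitor (P := 𝒰) hA
    exact ⟨congrArg (Kleisli.mk M) h, (congrArg (Kleisli.Adjunction.toKleisli M).map e).trans
      (eqToHom_map (Kleisli.Adjunction.toKleisli M) h)⟩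
  rightUnitor {A} hA := by
    obtain ⟨h, e⟩ := IsStrictMonoidalSubcategory.rightUnitor (P := 𝒰) hA
    exact ⟨congrArg (Kleisli.mk M) h, (congrArg (Kleisli.Adjunction.toKleisli M).map e).trans
      (eqToHom_map (Kleisli.Adjunction.toKleisli M) h)⟩

end KleisliMonoidal


/-! ### Change of base -/

section ChangeOfBase

variable {V : Type u₁} [Category.{v₁} V] [MonoidalCategory V] [SymmetricCategory V]
  {K : Type u₂} [Category.{v₂} K] [MonoidalCategory K] [SymmetricCategory K]
  (G : V ⥤ K) [G.LaxMonoidal] (P : ObjectProperty K) [IsStrictMonoidalSubcategory P]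
  (C : Type u₃) [EnrichedCategory V C]

/-- The 2-category `(P/G)_* C` obtained from the `V`-category `C` by change of base along
`V ⥤ K ⥤ cat`, the composite of `G` and the partial slice functor. -/
abbrev ParamCat := CatEnriched (TransportEnrichment (G ⋙ PartialSlice.functor P) C)

variable {C}

/-- An object of `C` as a 0-cell of `(P/G)_* C`. -/
def zeroCell (X : C) : ParamCat G P C := X

/-- The 1-cells from `X` to `Y`. -/
abbrev Cell₁ (X Y : C) := zeroCell G P X ⟶ zeroCell G P Y

variable {G P}

/-- The 1-cell given by `f : U ⟶ G C(X, Y)` with parameter space `U` in `P`. -/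
def Cell₁.mk (G : V ⥤ K) [G.LaxMonoidal] (P : ObjectProperty K) [IsStrictMonoidalSubcategory P]
    (X Y : C) (U : K) (hU : P U) (f : U ⟶ G.obj (X ⟶[V] Y)) : Cell₁ G P X Y :=
  PartialSlice.mkObj U hU f

/-- The parameter space of a 1-cell. -/
def Cell₁.dom {X Y : C} (f : Cell₁ G P X Y) : K :=
  CostructuredArrow.left (S := P.ι) (T := G.obj (X ⟶[V] Y)) f |>.obj

theorem Cell₁.dom_mem {X Y : C} (f : Cell₁ G P X Y) : P f.dom :=
  CostructuredArrow.left (S := P.ι) (T := G.obj (X ⟶[V] Y)) f |>.property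

/-- The arrow `U ⟶ G C(X, Y)` of a 1-cell. -/
def Cell₁.arr {X Y : C} (f : Cell₁ G P X Y) : f.dom ⟶ G.obj (X ⟶[V] Y) :=
  CostructuredArrow.hom (S := P.ι) (T := G.obj (X ⟶[V] Y)) f

/-- The map of parameter spaces of a 2-cell. -/
def Cell₁.reparam {X Y : C} {f g : Cell₁ G P X Y} (φ : f ⟶ g) : f.dom ⟶ g.dom :=
  PartialSlice.leftHom (A := G.obj (X ⟶[V] Y)) φ

variable (G P) in
/-- The action of the monoidal product of `C` on the cells of `(P/G)_* C`: on hom-categories it is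
`N C(X₁, Y₁) × N C(X₂, Y₂) ⥤ N (C(X₁, Y₁) ⊗ C(X₂, Y₂)) ⥤ N C(X₁ ⊠ X₂, Y₁ ⊠ Y₂)`, where `N` is
the composite of `G` and the partial slice functor. -/
def tensorCells (T : MonoidalEnrichedCategory V C) :
    PrelaxFunctor (ParamCat G P C × ParamCat G P C) (ParamCat G P C) where
  obj X := zeroCell G P (T.obj X.1 X.2)
  map {X Y} f := (μ (G ⋙ PartialSlice.functor P) _ _ ≫
    (G ⋙ PartialSlice.functor P).map (T.hom X.1 Y.1 X.2 Y.2)).toFunctor.obj (f.1, f.2)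
  map₂ {X Y _ _} φ := (μ (G ⋙ PartialSlice.functor P) _ _ ≫
    (G ⋙ PartialSlice.functor P).map (T.hom X.1 Y.1 X.2 Y.2)).toFunctor.map (φ.1, φ.2)
  map₂_id _ := CategoryTheory.Functor.map_id _ _
  map₂_comp _ _ := CategoryTheory.Functor.map_comp _ _ _

end ChangeOfBase

end ParamUncertainty

open ParamUncertainty MonoidalCategory Functor.LaxMonoidal

set_option linter.unusedSectionVars false

/-! Write `K` for the Kleisli category and `G` for `F` followed by `L`; most of the argument uses
only that `K` is symmetric monoidal, `G` is lax braided and `P` is a strict monoidal subcategory of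
`K`. A 2-cell is determined by its map of parameter spaces (`reparam_injective`), and an arrow of
`K` between parameter spaces is a 2-cell exactly when it commutes with the arrows into `G C(X, Y)`.
So constructing a 2-cell means checking one triangle over `G C(X, Y)`, and an equation of 2-cells is
an equation in `K`.

The 2-category is strict, so its associators and unitors are transported identities. Strictness of
`P` says the same of the associators and unitors of `K` at parameter spaces, and two parallel
transported identities agree. Hence the structural 2-cells may be replaced by the coherence maps of
`K` (`reparam_associator` and its companions), and the pseudofunctor laws for the product become the
statement that `⊗ : K × K ⥤ K` is strong monoidal through the middle four interchange. The
tensorator is a 2-cell because `⊠` is a `V`-functor and `G` respects the braiding (`tensorδ_arr`).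

The coherence 1-cells come from global elements of hom objects and have parameter space `I`. Since
`I ⊗ I = I`, such cells compose and tensor exactly as in the underlying category of `C`
(`elemCell_comp`, `tensorCell₁_elemCell`), so pentagon, triangle, hexagon and invertibility carry
over on the nose. `V`-naturality yields naturality 2-cells whose parameter map is, up to unitors, an
associator, unitor or braiding of `K` (`elemTrans`). The first two kinds are identities on `P`,
which gives strict 2-naturality of `a`, `l`, `r`; the braiding gives the swap for `s`. -/

namespace ParamUncertainty

/-- An arrow that is an identity up to an equality of objects. -/
def IsEqToHom {K : Type u₁} [Category.{v₁} K] {X Y : K} (φ : X ⟶ Y) : Prop :=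
  ∃ h : X = Y, φ = eqToHom h

/-! ### Arrows that are identities up to an equality of objects. -/

namespace IsEqToHom

section

variable {K : Type u₁} [Category.{v₁} K]

theorem eqToHom' {X Y : K} (h : X = Y) : IsEqToHom (eqToHom h) := ⟨h, rfl⟩

theorem id (X : K) : IsEqToHom (𝟙 X) := ⟨rfl, rfl⟩

theorem comp {X Y Z : K} {φ : X ⟶ Y} {ψ : Y ⟶ Z} (hφ : IsEqToHom φ) (hψ : IsEqToHom ψ) :
    IsEqToHom (φ ≫ ψ) := by
  obtain ⟨rfl, rfl⟩ := hφ
  obtain ⟨rfl, rfl⟩ := hψ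
  exact ⟨rfl, by simp⟩

theorem inv {X Y : K} {φ : X ⟶ Y} {ψ : Y ⟶ X} (hφ : IsEqToHom φ) (h : φ ≫ ψ = 𝟙 X) :
    IsEqToHom ψ := by
  obtain ⟨rfl, rfl⟩ := hφ
  exact ⟨rfl, by simpa using h⟩

/-- Equality proofs are irrelevant. This replaces any coherence computation between parallel
structural arrows on parameter spaces. -/
theorem unique {X Y : K} {φ ψ : X ⟶ Y} (hφ : IsEqToHom φ) (hψ : IsEqToHom ψ) : φ = ψ :=
  hφ.2.trans hψ.2.symm

end

variable {K : Type u₁} [Category.{v₁} K] [MonoidalCategory K]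

theorem tensor {X X' Y Y' : K} {φ : X ⟶ X'} {ψ : Y ⟶ Y'} (hφ : IsEqToHom φ) (hψ : IsEqToHom ψ) :
    IsEqToHom (φ ⊗ₘ ψ) := by
  obtain ⟨rfl, rfl⟩ := hφ
  obtain ⟨rfl, rfl⟩ := hψ
  exact ⟨rfl, by simp⟩

theorem whiskerLeft (X : K) {Y Y' : K} {ψ : Y ⟶ Y'} (hψ : IsEqToHom ψ) : IsEqToHom (X ◁ ψ) := by
  obtain ⟨rfl, rfl⟩ := hψ
  exact ⟨rfl, by simp⟩

theorem whiskerRight {X X' : K} {φ : X ⟶ X'} (hφ : IsEqToHom φ) (Y : K) : IsEqToHom (φ ▷ Y) := by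
  obtain ⟨rfl, rfl⟩ := hφ
  exact ⟨rfl, by simp⟩

variable {P : ObjectProperty K} [IsStrictMonoidalSubcategory P]

theorem associator {A B C : K} (hA : P A) (hB : P B) (hC : P C) : IsEqToHom (α_ A B C).hom :=
  IsStrictMonoidalSubcategory.associator hA hB hC

theorem leftUnitor {A : K} (hA : P A) : IsEqToHom (λ_ A).hom :=
  IsStrictMonoidalSubcategory.leftUnitor hA

theorem rightUnitor {A : K} (hA : P A) : IsEqToHom (ρ_ A).hom :=
  IsStrictMonoidalSubcategory.rightUnitor hA

end IsEqToHom

/-! ### 1-cells and 2-cells through their parameter spaces. -/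

section Cells

variable {V : Type u₁} [Category.{v₁} V] [MonoidalCategory V] [SymmetricCategory V]
  {K : Type u₂} [Category.{v₂} K] [MonoidalCategory K] [SymmetricCategory K]
  {G : V ⥤ K} [G.LaxMonoidal] {P : ObjectProperty K} [IsStrictMonoidalSubcategory P]
  {C : Type u₃} [EnrichedCategory V C]

/-- Allowing any `k` with `IsEqToHom k`, rather than a literal `eqToHom`, lets a unitor of `K`
witness an equality of 1-cells. -/
theorem Cell₁.ext_of_isEqToHom {X Y : C} {f g : Cell₁ G P X Y} {k : f.dom ⟶ g.dom}
    (hk : IsEqToHom k) (w : k ≫ g.arr = f.arr) : f = g := by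
  obtain ⟨h, rfl⟩ := hk
  exact PartialSlice.obj_eq h w.symm

/-- The other component of an arrow in the comma category lives in a discrete one-object category.
All equations of 2-cells are moved to `K` by this lemma. -/
theorem reparam_injective {X Y : C} {f g : Cell₁ G P X Y} {φ ψ : f ⟶ g}
    (h : Cell₁.reparam φ = Cell₁.reparam ψ) : φ = ψ := by
  apply CostructuredArrow.hom_ext (S := P.ι) (T := G.obj (X ⟶[V] Y))
  exact InducedCategory.hom_ext h

theorem reparam_w {X Y : C} {f g : Cell₁ G P X Y} (φ : f ⟶ g) :
    Cell₁.reparam φ ≫ g.arr = f.arr :=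
  CostructuredArrow.w (S := P.ι) (T := G.obj (X ⟶[V] Y)) φ

/-- The 2-cell with given map of parameter spaces. -/
def cell₂ {X Y : C} {f g : Cell₁ G P X Y} (φ : f.dom ⟶ g.dom) (w : φ ≫ g.arr = f.arr) : f ⟶ g :=
  CostructuredArrow.homMk (S := P.ι) (T := G.obj (X ⟶[V] Y)) (ObjectProperty.homMk φ) w

theorem isEqToHom_reparam {X Y : C} {f g : Cell₁ G P X Y} (h : f = g) :
    IsEqToHom (Cell₁.reparam (eqToHom h)) := by
  subst h
  exact .id _

/-- The triangle satisfied by a 2-cell already forces its source and target 1-cells to coincide once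
its parameter map is a transported identity. -/
theorem isIdentityCell_of_reparam {X Y : C} {f g : Cell₁ G P X Y} {φ : f ⟶ g}
    (h : IsEqToHom (Cell₁.reparam φ)) : IsIdentityCell φ := by
  have e := Cell₁.ext_of_isEqToHom h (reparam_w φ)
  exact ⟨e, reparam_injective (h.unique (isEqToHom_reparam e))⟩

/-- The invertible 2-cell with given map of parameter spaces. -/
def cellIso {X Y : C} {f g : Cell₁ G P X Y} (φ : f.dom ≅ g.dom) (w : φ.hom ≫ g.arr = f.arr) :
    f ≅ g where
  hom := cell₂ φ.hom w
  inv := cell₂ φ.inv (by rw [← w, Iso.inv_hom_id_assoc])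
  hom_inv_id := reparam_injective φ.hom_inv_id
  inv_hom_id := reparam_injective φ.inv_hom_id

theorem arr_comp {X Y Z : C} (f : Cell₁ G P X Y) (g : Cell₁ G P Y Z) :
    Cell₁.arr (X := X) (Y := Z) (f ≫ g) =
      (f.arr ⊗ₘ g.arr) ≫ μ G (X ⟶[V] Y) (Y ⟶[V] Z) ≫ G.map (eComp V X Y Z) :=
  Category.assoc _ _ _

theorem reparam_whiskerLeft {X Y Z : C} (f : Cell₁ G P X Y) {g h : Cell₁ G P Y Z} (η : g ⟶ h) :
    Cell₁.reparam (X := X) (Y := Z) (Bicategory.whiskerLeft f η) =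
      MonoidalCategory.whiskerLeft f.dom (Cell₁.reparam η) :=
  id_tensorHom f.dom (Cell₁.reparam η)

theorem reparam_whiskerRight {X Y Z : C} {f g : Cell₁ G P X Y} (η : f ⟶ g) (h : Cell₁ G P Y Z) :
    Cell₁.reparam (X := X) (Y := Z) (Bicategory.whiskerRight η h) =
      MonoidalCategory.whiskerRight (Cell₁.reparam η) h.dom :=
  tensorHom_id (Cell₁.reparam η) h.dom

/-- Both sides are transported identities: the left because the 2-category is strict, the right
because `P` is strict. Writing the trivial 2-cell as an associator of `K` makes the coherence laws
of `K` applicable. -/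
theorem reparam_associator {X Y Z X' : C} (f : Cell₁ G P X Y) (g : Cell₁ G P Y Z)
    (h : Cell₁ G P Z X') :
    Cell₁.reparam (X := X) (Y := X') (Bicategory.associator f g h).hom =
      (MonoidalCategory.associator f.dom g.dom h.dom).hom :=
  (isEqToHom_reparam (X := X) (Y := X') (Category.assoc f g h)).unique
    (IsEqToHom.associator f.dom_mem g.dom_mem h.dom_mem)

theorem reparam_leftUnitor {X Y : C} (f : Cell₁ G P X Y) :
    Cell₁.reparam (X := X) (Y := Y) (Bicategory.leftUnitor f).hom =
      (MonoidalCategory.leftUnitor f.dom).hom :=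
  (isEqToHom_reparam (X := X) (Y := Y) (Category.id_comp f)).unique
    (IsEqToHom.leftUnitor f.dom_mem)

theorem reparam_rightUnitor {X Y : C} (f : Cell₁ G P X Y) :
    Cell₁.reparam (X := X) (Y := Y) (Bicategory.rightUnitor f).hom =
      (MonoidalCategory.rightUnitor f.dom).hom :=
  (isEqToHom_reparam (X := X) (Y := Y) (Category.comp_id f)).unique
    (IsEqToHom.rightUnitor f.dom_mem)

end Cells

/-! ### Calculus of arrows into the image of a lax monoidal functor. -/

section LaxFunctor

variable {V : Type u₁} [Category.{v₁} V] [MonoidalCategory V]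
  {K : Type u₂} [Category.{v₂} K] [MonoidalCategory K] (G : V ⥤ K) [G.LaxMonoidal]

theorem tensor_map_μ_map {U₁ U₂ : K} {A₁ A₂ B₁ B₂ D : V} (u : U₁ ⟶ G.obj A₁) (v : U₂ ⟶ G.obj A₂)
    (x : A₁ ⟶ B₁) (y : A₂ ⟶ B₂) (z : B₁ ⊗ B₂ ⟶ D) :
    ((u ≫ G.map x) ⊗ₘ (v ≫ G.map y)) ≫ μ G B₁ B₂ ≫ G.map z =
      (u ⊗ₘ v) ≫ μ G A₁ A₂ ≫ G.map ((x ⊗ₘ y) ≫ z) := by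
  rw [← tensorHom_comp_tensorHom, Category.assoc, Functor.LaxMonoidal.μ_natural_assoc,
    G.map_comp]

theorem tensor_map_left_μ_map {U₁ U₂ : K} {A₁ A₂ B₁ D : V} (u : U₁ ⟶ G.obj A₁)
    (v : U₂ ⟶ G.obj A₂) (x : A₁ ⟶ B₁) (z : B₁ ⊗ A₂ ⟶ D) :
    ((u ≫ G.map x) ⊗ₘ v) ≫ μ G B₁ A₂ ≫ G.map z =
      (u ⊗ₘ v) ≫ μ G A₁ A₂ ≫ G.map ((x ▷ A₂) ≫ z) := by
  rw [← tensorHom_id, ← tensor_map_μ_map, G.map_id, Category.comp_id]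

theorem tensor_map_right_μ_map {U₁ U₂ : K} {A₁ A₂ B₂ D : V} (u : U₁ ⟶ G.obj A₁)
    (v : U₂ ⟶ G.obj A₂) (y : A₂ ⟶ B₂) (z : A₁ ⊗ B₂ ⟶ D) :
    (u ⊗ₘ (v ≫ G.map y)) ≫ μ G A₁ B₂ ≫ G.map z =
      (u ⊗ₘ v) ≫ μ G A₁ A₂ ≫ G.map ((A₁ ◁ y) ≫ z) := by
  rw [← id_tensorHom, ← tensor_map_μ_map, G.map_id, Category.comp_id]

theorem ε_tensor_μ {U : K} {A : V} (u : U ⟶ G.obj A) :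
    (ε G ⊗ₘ u) ≫ μ G (𝟙_ V) A = (λ_ U).hom ≫ u ≫ G.map (λ_ A).inv := by
  rw [← cancel_mono (G.map (λ_ A).hom), Category.assoc, Category.assoc, Category.assoc,
    ← G.map_comp, Iso.inv_hom_id, G.map_id, Category.comp_id, ← leftUnitor_naturality,
    Functor.LaxMonoidal.left_unitality, MonoidalCategory.tensorHom_def', Category.assoc]

theorem tensor_ε_μ {U : K} {A : V} (u : U ⟶ G.obj A) :
    (u ⊗ₘ ε G) ≫ μ G A (𝟙_ V) = (ρ_ U).hom ≫ u ≫ G.map (ρ_ A).inv := by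
  rw [← cancel_mono (G.map (ρ_ A).hom), Category.assoc, Category.assoc, Category.assoc,
    ← G.map_comp, Iso.inv_hom_id, G.map_id, Category.comp_id, ← rightUnitor_naturality,
    Functor.LaxMonoidal.right_unitality, MonoidalCategory.tensorHom_def, Category.assoc]

/-- By unitality of `G`, a global element in one tensor factor only costs a unitor on parameter
spaces; the rest of the expression is computed in `V`. -/
theorem elem_tensor_μ_map {U : K} {A B D : V} (x : 𝟙_ V ⟶ A) (u : U ⟶ G.obj B) (z : A ⊗ B ⟶ D) :
    ((ε G ≫ G.map x) ⊗ₘ u) ≫ μ G A B ≫ G.map z =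
      (λ_ U).hom ≫ u ≫ G.map ((λ_ B).inv ≫ (x ▷ B) ≫ z) := by
  rw [tensor_map_left_μ_map, ← Category.assoc, ε_tensor_μ]
  simp only [G.map_comp, Category.assoc]

theorem tensor_elem_μ_map {U : K} {A B D : V} (u : U ⟶ G.obj A) (x : 𝟙_ V ⟶ B) (z : A ⊗ B ⟶ D) :
    (u ⊗ₘ (ε G ≫ G.map x)) ≫ μ G A B ≫ G.map z =
      (ρ_ U).hom ≫ u ≫ G.map ((ρ_ A).inv ≫ (A ◁ x) ≫ z) := by
  rw [tensor_map_right_μ_map, ← Category.assoc, tensor_ε_μ]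
  simp only [G.map_comp, Category.assoc]

end LaxFunctor

/-! ### The middle four interchange in a symmetric monoidal category. -/

section Symmetric

variable {K : Type u₁} [Category.{v₁} K] [MonoidalCategory K] [SymmetricCategory K]

/-- `tensorδ` and `tensorμ` as an isomorphism. -/
@[simps]
def tensorδIso (X₁ X₂ Y₁ Y₂ : K) : (X₁ ⊗ Y₁) ⊗ (X₂ ⊗ Y₂) ≅ (X₁ ⊗ X₂) ⊗ (Y₁ ⊗ Y₂) where
  hom := tensorδ X₁ X₂ Y₁ Y₂
  inv := tensorμ X₁ X₂ Y₁ Y₂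

instance (X₁ X₂ Y₁ Y₂ : K) : IsIso (tensorμ X₁ X₂ Y₁ Y₂) :=
  (tensorδIso X₁ X₂ Y₁ Y₂).isIso_inv

/-- Compatibility of the swap with tensorators. In the auxiliary form with `tensorμ`, the factors
`X₂` and `Y₁` cross twice on one side and not at all on the other, so a symmetry is needed and a
braiding does not suffice. -/
theorem tensorδ_braiding (X₁ X₂ Y₁ Y₂ : K) :
    (β_ (X₁ ⊗ Y₁) (X₂ ⊗ Y₂)).hom ≫ tensorδ X₂ X₁ Y₂ Y₁ =
      tensorδ X₁ X₂ Y₁ Y₂ ≫ ((β_ X₁ X₂).hom ⊗ₘ (β_ Y₁ Y₂).hom) := by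
  have h : tensorμ X₁ X₂ Y₁ Y₂ ≫ (β_ (X₁ ⊗ Y₁) (X₂ ⊗ Y₂)).hom =
      ((β_ X₁ X₂).hom ⊗ₘ (β_ Y₁ Y₂).hom) ≫ tensorμ X₂ X₁ Y₂ Y₁ := by
    simp [tensorμ, SymmetricCategory.braiding_swap_eq_inv_braiding Y₁ X₂, MonoidalCategory.tensorHom_def]
  rw [← cancel_epi (tensorμ X₁ X₂ Y₁ Y₂), reassoc_of% h, tensorμ_tensorδ,
    tensorμ_tensorδ_assoc, Category.comp_id]

/-- This and the next four identities are the five pseudofunctor laws of the product, read on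
parameter spaces. -/
theorem whiskerLeft_eq_tensorδ (X₁ X₂ : K) {Y₁ Y₂ Z₁ Z₂ : K} (f₁ : Y₁ ⟶ Z₁) (f₂ : Y₂ ⟶ Z₂) :
    X₁ ◁ f₁ ⊗ₘ X₂ ◁ f₂ =
      tensorδ X₁ X₂ Y₁ Y₂ ≫ (X₁ ⊗ X₂) ◁ (f₁ ⊗ₘ f₂) ≫ tensorμ X₁ X₂ Z₁ Z₂ := by
  rw [tensorμ_natural_right, tensorδ_tensorμ_assoc]

theorem whiskerRight_eq_tensorδ {Y₁ Y₂ Z₁ Z₂ : K} (f₁ : Y₁ ⟶ Z₁) (f₂ : Y₂ ⟶ Z₂) (X₁ X₂ : K) :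
    f₁ ▷ X₁ ⊗ₘ f₂ ▷ X₂ =
      tensorδ Y₁ Y₂ X₁ X₂ ≫ (f₁ ⊗ₘ f₂) ▷ (X₁ ⊗ X₂) ≫ tensorμ Z₁ Z₂ X₁ X₂ := by
  rw [tensorμ_natural_left, tensorδ_tensorμ_assoc]

theorem associator_eq_tensorδ (X₁ X₂ Y₁ Y₂ Z₁ Z₂ : K) :
    (α_ X₁ Y₁ Z₁).hom ⊗ₘ (α_ X₂ Y₂ Z₂).hom =
      tensorδ (X₁ ⊗ Y₁) (X₂ ⊗ Y₂) Z₁ Z₂ ≫ tensorδ X₁ X₂ Y₁ Y₂ ▷ (Z₁ ⊗ Z₂) ≫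
        (α_ (X₁ ⊗ X₂) (Y₁ ⊗ Y₂) (Z₁ ⊗ Z₂)).hom ≫ (X₁ ⊗ X₂) ◁ tensorμ Y₁ Y₂ Z₁ Z₂ ≫
          tensorμ X₁ X₂ (Y₁ ⊗ Z₁) (Y₂ ⊗ Z₂) := by
  rw [← tensor_associativity, ← comp_whiskerRight_assoc, tensorδ_tensorμ, id_whiskerRight,
    Category.id_comp, tensorδ_tensorμ_assoc]

theorem leftUnitor_eq_tensorδ (X₁ X₂ : K) :
    (λ_ X₁).hom ⊗ₘ (λ_ X₂).hom =
      tensorδ (𝟙_ K) (𝟙_ K) X₁ X₂ ≫ (λ_ (𝟙_ K)).hom ▷ (X₁ ⊗ X₂) ≫ (λ_ (X₁ ⊗ X₂)).hom := by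
  rw [tensor_left_unitality, ← comp_whiskerRight_assoc, Iso.hom_inv_id, id_whiskerRight,
    Category.id_comp, tensorδ_tensorμ_assoc]

theorem rightUnitor_eq_tensorδ (X₁ X₂ : K) :
    (ρ_ X₁).hom ⊗ₘ (ρ_ X₂).hom =
      tensorδ X₁ X₂ (𝟙_ K) (𝟙_ K) ≫ (X₁ ⊗ X₂) ◁ (λ_ (𝟙_ K)).hom ≫ (ρ_ (X₁ ⊗ X₂)).hom := by
  rw [tensor_right_unitality, ← whiskerLeft_comp_assoc, Iso.hom_inv_id, whiskerLeft_id,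
    Category.id_comp, tensorδ_tensorμ_assoc]

/-- This is `associator_monoidal` with the interchanges inverted; it makes the associator compatible
with composition of 1-cells. -/
theorem associator_tensorδ (X₁ X₂ X₃ Y₁ Y₂ Y₃ : K) :
    (α_ (X₁ ⊗ Y₁) (X₂ ⊗ Y₂) (X₃ ⊗ Y₃)).hom ≫ (X₁ ⊗ Y₁) ◁ tensorδ X₂ X₃ Y₂ Y₃ ≫
        tensorδ X₁ (X₂ ⊗ X₃) Y₁ (Y₂ ⊗ Y₃) =
      tensorδ X₁ X₂ Y₁ Y₂ ▷ (X₃ ⊗ Y₃) ≫ tensorδ (X₁ ⊗ X₂) X₃ (Y₁ ⊗ Y₂) Y₃ ≫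
        ((α_ X₁ X₂ X₃).hom ⊗ₘ (α_ Y₁ Y₂ Y₃).hom) := by
  have h := associator_monoidal X₁ X₂ X₃ Y₁ Y₂ Y₃
  have e : tensorμ X₁ X₂ Y₁ Y₂ ▷ (X₃ ⊗ Y₃) ≫ tensorδ X₁ X₂ Y₁ Y₂ ▷ (X₃ ⊗ Y₃) = 𝟙 _ := by
    rw [← comp_whiskerRight, tensorμ_tensorδ, id_whiskerRight]
  have e' : (X₁ ⊗ Y₁) ◁ tensorμ X₂ X₃ Y₂ Y₃ ≫ (X₁ ⊗ Y₁) ◁ tensorδ X₂ X₃ Y₂ Y₃ = 𝟙 _ := by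
    rw [← whiskerLeft_comp, tensorμ_tensorδ, whiskerLeft_id]
  have e'' : tensorδ X₁ X₂ Y₁ Y₂ ▷ (X₃ ⊗ Y₃) ≫ tensorμ X₁ X₂ Y₁ Y₂ ▷ (X₃ ⊗ Y₃) = 𝟙 _ := by
    rw [← comp_whiskerRight, tensorδ_tensorμ, id_whiskerRight]
  calc _ = tensorδ X₁ X₂ Y₁ Y₂ ▷ (X₃ ⊗ Y₃) ≫ tensorδ (X₁ ⊗ X₂) X₃ (Y₁ ⊗ Y₂) Y₃ ≫
        (tensorμ (X₁ ⊗ X₂) X₃ (Y₁ ⊗ Y₂) Y₃ ≫ tensorμ X₁ X₂ Y₁ Y₂ ▷ (X₃ ⊗ Y₃) ≫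
          (α_ (X₁ ⊗ Y₁) (X₂ ⊗ Y₂) (X₃ ⊗ Y₃)).hom) ≫ (X₁ ⊗ Y₁) ◁ tensorδ X₂ X₃ Y₂ Y₃ ≫
        tensorδ X₁ (X₂ ⊗ X₃) Y₁ (Y₂ ⊗ Y₃) := by
        simp only [Category.assoc, tensorδ_tensorμ_assoc, reassoc_of% e'']
    _ = _ := by
        rw [h]
        simp only [Category.assoc, reassoc_of% e', tensorμ_tensorδ, Category.comp_id]

/-- Compatibility with composition for a 2-cell of the form `ρ ≫ k ≫ λ⁻¹`. -/
theorem unitors_conj_comp {A A' B B' D D' : K} {k : A ⟶ A'} {kf : B ⟶ B'} {kg : D ⟶ D'}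
    {m : A ⟶ B ⊗ D} {m' : A' ⟶ B' ⊗ D'} (h : k ≫ m' = m ≫ (kf ⊗ₘ kg)) :
    ((ρ_ A).hom ≫ k ≫ (λ_ A').inv) ≫ 𝟙_ K ◁ m' =
      m ▷ 𝟙_ K ≫ (α_ B D (𝟙_ K)).hom ≫ B ◁ ((ρ_ D).hom ≫ kg ≫ (λ_ D').inv) ≫
        (α_ B (𝟙_ K) D').inv ≫ ((ρ_ B).hom ≫ kf ≫ (λ_ B').inv) ▷ D' ≫ (α_ (𝟙_ K) B' D').hom := by
  have h1 : ((ρ_ A).hom ≫ k ≫ (λ_ A').inv) ≫ 𝟙_ K ◁ m' = (ρ_ A).hom ≫ (k ≫ m') ≫ (λ_ _).inv := by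
    simp
  rw [h1, h]
  -- The primed form of the interchange puts `kg` before `kf`, the order in which they occur on the
  -- right-hand side; what remains is pure coherence.
  simp only [tensorHom_def', whiskerLeft_comp, comp_whiskerRight, Category.assoc]
  monoidal

theorem unitors_conj_naturality {A A' B B' : K} {k : A ⟶ A'} {l : B ⟶ B'} {a : A ⟶ B} {a' : A' ⟶ B'}
    (h : a ≫ l = k ≫ a') :
    a ▷ 𝟙_ K ≫ (ρ_ B).hom ≫ l ≫ (λ_ B').inv =
      ((ρ_ A).hom ≫ k ≫ (λ_ A').inv) ≫ 𝟙_ K ◁ a' := by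
  simp [reassoc_of% h]

end Symmetric

/-! ### Cells from global elements, and the product pseudofunctor. -/

section TensorCells

variable {V : Type u₁} [Category.{v₁} V] [MonoidalCategory V] [SymmetricCategory V]
  {K : Type u₂} [Category.{v₂} K] [MonoidalCategory K] [SymmetricCategory K]
  (G : V ⥤ K) [G.LaxBraided] (P : ObjectProperty K) [IsStrictMonoidalSubcategory P]
  {C : Type u₃} [EnrichedCategory V C]

/-- The 1-cell with parameter space `𝟙_ K` given by a global element of `C(X, Y)`. -/
def elemCell {X Y : C} (x : 𝟙_ V ⟶ (X ⟶[V] Y)) : Cell₁ G P X Y :=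
  Cell₁.mk G P X Y (𝟙_ K) P.prop_unit (ε G ≫ G.map x)

theorem id_eq_elemCell (X : C) : 𝟙 (zeroCell G P X) = elemCell G P (eId V X) :=
  Cell₁.ext_of_isEqToHom (X := X) (Y := X) (.id (𝟙_ K)) (by
    refine (Category.id_comp _).trans ?_
    change ε G ≫ G.map (eId V X) = (𝟙 (𝟙_ K) ≫ ε G) ≫ G.map (eId V X)
    rw [Category.id_comp])

/-- The two parameter spaces are `I` and `I ⊗ I`, which strictness identifies along the unitor. Thus
equations in the underlying category of `C` become strict equations of 1-cells. -/
theorem elemCell_comp {X Y Z : C} (x : 𝟙_ V ⟶ (X ⟶[V] Y)) (y : 𝟙_ V ⟶ (Y ⟶[V] Z)) :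
    elemCell G P x ≫ elemCell G P y = elemCell G P (elemComp x y) :=
  Cell₁.ext_of_isEqToHom (X := X) (Y := Z) (IsEqToHom.leftUnitor (P := P) P.prop_unit) (by
    refine Eq.trans ?_ (arr_comp _ _).symm
    change (λ_ (𝟙_ K)).hom ≫ ε G ≫ G.map ((λ_ (𝟙_ V)).inv ≫ (x ⊗ₘ y) ≫ eComp V X Y Z) =
      ((ε G ≫ G.map x) ⊗ₘ (ε G ≫ G.map y)) ≫ μ G _ _ ≫ G.map (eComp V X Y Z)
    rw [elem_tensor_μ_map, MonoidalCategory.tensorHom_def', Category.assoc]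
    simp only [Category.assoc, ← G.map_comp, leftUnitor_inv_naturality_assoc])

theorem isInvertible_elemCell {X Y : C} (x : 𝟙_ V ⟶ (X ⟶[V] Y)) (y : 𝟙_ V ⟶ (Y ⟶[V] X))
    (h : elemComp x y = eId V X) (h' : elemComp y x = eId V Y) :
    IsInvertible (elemCell G P x) :=
  ⟨elemCell G P y, by rw [elemCell_comp, h, id_eq_elemCell],
    by rw [elemCell_comp, h', id_eq_elemCell]⟩

variable (T : MonoidalEnrichedCategory V C)

/-- The product of 1-cells. -/
abbrev tensorCell₁ {X₁ Y₁ X₂ Y₂ : C} (f₁ : Cell₁ G P X₁ Y₁) (f₂ : Cell₁ G P X₂ Y₂) :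
    Cell₁ G P (T.obj X₁ X₂) (T.obj Y₁ Y₂) :=
  (tensorCells G P T).map (Prod.mkHom f₁ f₂)

theorem arr_tensorCell₁ {X₁ Y₁ X₂ Y₂ : C} (f₁ : Cell₁ G P X₁ Y₁) (f₂ : Cell₁ G P X₂ Y₂) :
    (tensorCell₁ G P T f₁ f₂).arr =
      (f₁.arr ⊗ₘ f₂.arr) ≫ μ G (X₁ ⟶[V] Y₁) (X₂ ⟶[V] Y₂) ≫ G.map (T.hom X₁ Y₁ X₂ Y₂) :=
  Category.assoc _ _ _

theorem tensorCell₁_elemCell {X₁ Y₁ X₂ Y₂ : C} (x : 𝟙_ V ⟶ (X₁ ⟶[V] Y₁))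
    (y : 𝟙_ V ⟶ (X₂ ⟶[V] Y₂)) :
    tensorCell₁ G P T (elemCell G P x) (elemCell G P y) =
      elemCell G P ((λ_ (𝟙_ V)).inv ≫ (x ⊗ₘ y) ≫ T.hom X₁ Y₁ X₂ Y₂) :=
  Cell₁.ext_of_isEqToHom (IsEqToHom.leftUnitor (P := P) P.prop_unit) (by
    refine Eq.trans ?_ (arr_tensorCell₁ G P T _ _).symm
    change (λ_ (𝟙_ K)).hom ≫ ε G ≫ G.map ((λ_ (𝟙_ V)).inv ≫ (x ⊗ₘ y) ≫ T.hom X₁ Y₁ X₂ Y₂) =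
      ((ε G ≫ G.map x) ⊗ₘ (ε G ≫ G.map y)) ≫ μ G _ _ ≫ G.map (T.hom X₁ Y₁ X₂ Y₂)
    rw [elem_tensor_μ_map, MonoidalCategory.tensorHom_def', Category.assoc]
    simp only [Category.assoc, ← G.map_comp, leftUnitor_inv_naturality_assoc])

/-- The triangle that makes the interchange a 2-cell. It combines preservation of composition by `⊠`
with the compatibility of the comparison maps of `G` with the interchanges of `V` and `K`. -/
theorem tensorδ_arr {X₁ Y₁ Z₁ X₂ Y₂ Z₂ : C} (f₁ : Cell₁ G P X₁ Y₁) (f₂ : Cell₁ G P X₂ Y₂)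
    (g₁ : Cell₁ G P Y₁ Z₁) (g₂ : Cell₁ G P Y₂ Z₂) :
    tensorδ f₁.dom f₂.dom g₁.dom g₂.dom ≫
        Cell₁.arr (X := T.obj X₁ X₂) (Y := T.obj Z₁ Z₂)
          (tensorCell₁ G P T f₁ f₂ ≫ tensorCell₁ G P T g₁ g₂) =
      Cell₁.arr (X := T.obj X₁ X₂) (Y := T.obj Z₁ Z₂)
        (tensorCell₁ G P T (X₁ := X₁) (Y₁ := Z₁) (X₂ := X₂) (Y₂ := Z₂) (f₁ ≫ g₁) (f₂ ≫ g₂)) := by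
  rw [arr_comp, arr_tensorCell₁, arr_tensorCell₁, arr_tensorCell₁, arr_comp, arr_comp]
  have h1 := tensor_map_μ_map G ((f₁.arr ⊗ₘ f₂.arr) ≫ μ G _ _) ((g₁.arr ⊗ₘ g₂.arr) ≫ μ G _ _)
    (T.hom X₁ Y₁ X₂ Y₂) (T.hom Y₁ Z₁ Y₂ Z₂) (eComp V (T.obj X₁ X₂) (T.obj Y₁ Y₂) (T.obj Z₁ Z₂))
  have h2 := tensor_map_μ_map G ((f₁.arr ⊗ₘ g₁.arr) ≫ μ G _ _) ((f₂.arr ⊗ₘ g₂.arr) ≫ μ G _ _)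
    (eComp V X₁ Y₁ Z₁) (eComp V X₂ Y₂ Z₂) (T.hom X₁ Z₁ X₂ Z₂)
  rw [Category.assoc, Category.assoc] at h1 h2
  refine Eq.trans (congrArg (tensorδ f₁.dom f₂.dom g₁.dom g₂.dom ≫ ·) h1) (Eq.trans ?_ h2.symm)
  -- `T.hom_comp` introduces an interchange in `V`; the braided structure of `G` turns it into one
  -- in `K`, which cancels the leading `tensorδ`.
  rw [← T.hom_comp, ← tensorHom_comp_tensorHom, ← tensorHom_comp_tensorHom, Category.assoc,
    Category.assoc, G.map_comp, ← tensorμ_comp_μ_tensorHom_μ_comp_μ_assoc,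
    tensorμ_natural_assoc, tensorδ_tensorμ_assoc]

theorem arr_id (X : C) :
    Cell₁.arr (X := X) (Y := X) (𝟙 (zeroCell G P X)) = ε G ≫ G.map (eId V X) := by
  change (𝟙 (𝟙_ K) ≫ ε G) ≫ G.map (eId V X) = ε G ≫ G.map (eId V X)
  rw [Category.id_comp]

theorem leftUnitor_arr_id (X₁ X₂ : C) :
    (λ_ (𝟙_ K)).hom ≫ Cell₁.arr (X := T.obj X₁ X₂) (Y := T.obj X₁ X₂)
        (𝟙 (zeroCell G P (T.obj X₁ X₂))) =
      (tensorCell₁ G P T (𝟙 (zeroCell G P X₁)) (𝟙 (zeroCell G P X₂))).arr := by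
  refine Eq.trans ?_ (arr_tensorCell₁ G P T (𝟙 (zeroCell G P X₁)) (𝟙 (zeroCell G P X₂))).symm
  refine (congrArg ((λ_ (𝟙_ K)).hom ≫ ·) (arr_id G P (T.obj X₁ X₂))).trans (Eq.trans ?_
    (congrArg₂ (fun x y => (x ⊗ₘ y) ≫ μ G _ _ ≫ G.map (T.hom X₁ X₁ X₂ X₂))
      (arr_id G P X₁) (arr_id G P X₂)).symm)
  change (λ_ (𝟙_ K)).hom ≫ ε G ≫ G.map (eId V (T.obj X₁ X₂)) =
    ((ε G ≫ G.map (eId V X₁)) ⊗ₘ (ε G ≫ G.map (eId V X₂))) ≫ μ G _ _ ≫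
      G.map (T.hom X₁ X₁ X₂ X₂)
  rw [elem_tensor_μ_map, ← T.hom_id, MonoidalCategory.tensorHom_def', Category.assoc]
  simp only [Category.assoc, ← G.map_comp, leftUnitor_inv_naturality_assoc]

section Congruence

variable {G P}

/-- The congruence lemmas of this section compute the parameter map of a pasting from those of its
pieces by unification, since parameter spaces of composites match only definitionally and rewriting
is awkward. -/
theorem reparam_comp_congr {X Y : C} {f g h : Cell₁ G P X Y} {φ : f ⟶ g} {ψ : g ⟶ h}
    {a : f.dom ⟶ g.dom} {b : g.dom ⟶ h.dom} (ha : Cell₁.reparam φ = a)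
    (hb : Cell₁.reparam ψ = b) : Cell₁.reparam (φ ≫ ψ) = a ≫ b :=
  ha ▸ hb ▸ rfl

theorem reparam_whiskerLeft_congr {X Y Z : C} (f : Cell₁ G P X Y) {g h : Cell₁ G P Y Z}
    {η : g ⟶ h} {a : g.dom ⟶ h.dom} (ha : Cell₁.reparam η = a) :
    Cell₁.reparam (X := X) (Y := Z) (Bicategory.whiskerLeft f η) = f.dom ◁ a :=
  ha ▸ reparam_whiskerLeft f η

theorem reparam_whiskerRight_congr {X Y Z : C} {f g : Cell₁ G P X Y} {η : f ⟶ g}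
    (h : Cell₁ G P Y Z) {a : f.dom ⟶ g.dom} (ha : Cell₁.reparam η = a) :
    Cell₁.reparam (X := X) (Y := Z) (Bicategory.whiskerRight η h) = a ▷ h.dom :=
  ha ▸ reparam_whiskerRight η h

theorem reparam_tensor_congr {X₁ Y₁ X₂ Y₂ : C} {f₁ g₁ : Cell₁ G P X₁ Y₁}
    {f₂ g₂ : Cell₁ G P X₂ Y₂} {φ₁ : f₁ ⟶ g₁} {φ₂ : f₂ ⟶ g₂} {a₁ : f₁.dom ⟶ g₁.dom}
    {a₂ : f₂.dom ⟶ g₂.dom} (h₁ : Cell₁.reparam φ₁ = a₁) (h₂ : Cell₁.reparam φ₂ = a₂) :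
    Cell₁.reparam (X := T.obj X₁ X₂) (Y := T.obj Y₁ Y₂) ((tensorCells G P T).map₂
        (Prod.mkHom φ₁ φ₂ : Prod.mkHom f₁ f₂ ⟶ Prod.mkHom g₁ g₂)) = a₁ ⊗ₘ a₂ :=
  h₁ ▸ h₂ ▸ rfl

end Congruence

/-- The pseudofunctor structure of the monoidal product, with the middle four interchange as
tensorator. -/
def tensorStructure : PseudoStructure (tensorCells G P T) where
  mapId X := cellIso (C := C) (X := T.obj X.1 X.2) (Y := T.obj X.1 X.2) (λ_ (𝟙_ K))
    (leftUnitor_arr_id (C := C) G P T X.1 X.2)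
  mapComp {X _ Z} f g := cellIso (C := C) (X := T.obj X.1 X.2) (Y := T.obj Z.1 Z.2)
    (tensorδIso (Cell₁.dom (C := C) f.1) (Cell₁.dom (C := C) f.2) (Cell₁.dom (C := C) g.1)
      (Cell₁.dom (C := C) g.2))
    (tensorδ_arr (C := C) G P T f.1 f.2 g.1 g.2)
  map₂_whiskerLeft {X _ Z} f _ _ η := reparam_injective (C := C) (X := T.obj X.1 X.2)
    (Y := T.obj Z.1 Z.2)
    (Eq.trans (reparam_tensor_congr (C := C) T (reparam_whiskerLeft (C := C) f.1 η.1)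
      (reparam_whiskerLeft (C := C) f.2 η.2)) (Eq.trans (whiskerLeft_eq_tensorδ _ _ _ _) (Eq.symm
    (reparam_comp_congr (C := C) rfl (reparam_comp_congr (C := C)
      (reparam_whiskerLeft_congr (C := C) (tensorCell₁ (C := C) G P T f.1 f.2) rfl) rfl)))))
  map₂_whiskerRight {X _ Z} _ _ η h := reparam_injective (C := C) (X := T.obj X.1 X.2)
    (Y := T.obj Z.1 Z.2)
    (Eq.trans (reparam_tensor_congr (C := C) T (reparam_whiskerRight (C := C) η.1 h.1)
      (reparam_whiskerRight (C := C) η.2 h.2)) (Eq.trans (whiskerRight_eq_tensorδ _ _ _ _) (Eq.symm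
    (reparam_comp_congr (C := C) rfl (reparam_comp_congr (C := C)
      (reparam_whiskerRight_congr (C := C) (tensorCell₁ (C := C) G P T h.1 h.2) rfl) rfl)))))
  map₂_associator {X _ _ X'} f g h := reparam_injective (C := C) (X := T.obj X.1 X.2)
    (Y := T.obj X'.1 X'.2)
    (Eq.trans (reparam_tensor_congr (C := C) T (reparam_associator (C := C) f.1 g.1 h.1)
      (reparam_associator (C := C) f.2 g.2 h.2)) (Eq.trans (associator_eq_tensorδ _ _ _ _ _ _) (Eq.symm
    (reparam_comp_congr (C := C) rfl (reparam_comp_congr (C := C)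
      (reparam_whiskerRight_congr (C := C) (tensorCell₁ (C := C) G P T h.1 h.2) rfl)
      (reparam_comp_congr (C := C) (reparam_associator (C := C)
        (tensorCell₁ (C := C) G P T f.1 f.2) (tensorCell₁ (C := C) G P T g.1 g.2)
        (tensorCell₁ (C := C) G P T h.1 h.2)) (reparam_comp_congr (C := C)
          (reparam_whiskerLeft_congr (C := C) (tensorCell₁ (C := C) G P T f.1 f.2) rfl)
            rfl)))))))
  map₂_leftUnitor {X Y} f := reparam_injective (C := C) (X := T.obj X.1 X.2)
    (Y := T.obj Y.1 Y.2)
    (Eq.trans (reparam_tensor_congr (C := C) T (reparam_leftUnitor (C := C) f.1)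
      (reparam_leftUnitor (C := C) f.2)) (Eq.trans (leftUnitor_eq_tensorδ _ _) (Eq.symm
    (reparam_comp_congr (C := C) rfl (reparam_comp_congr (C := C)
      (reparam_whiskerRight_congr (C := C) (tensorCell₁ (C := C) G P T f.1 f.2) rfl)
      (reparam_leftUnitor (C := C) (tensorCell₁ (C := C) G P T f.1 f.2)))))))
  map₂_rightUnitor {X Y} f := reparam_injective (C := C) (X := T.obj X.1 X.2)
    (Y := T.obj Y.1 Y.2)
    (Eq.trans (reparam_tensor_congr (C := C) T (reparam_rightUnitor (C := C) f.1)
      (reparam_rightUnitor (C := C) f.2)) (Eq.trans (rightUnitor_eq_tensorδ _ _) (Eq.symm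
    (reparam_comp_congr (C := C) rfl (reparam_comp_congr (C := C)
      (reparam_whiskerLeft_congr (C := C) (tensorCell₁ (C := C) G P T f.1 f.2) rfl)
      (reparam_rightUnitor (C := C) (tensorCell₁ (C := C) G P T f.1 f.2)))))))

end TensorCells

/-! ### Strong transformations with components given by global elements. -/

section ElemTrans

variable {V : Type u₁} [Category.{v₁} V] [MonoidalCategory V] [SymmetricCategory V]
  {K : Type u₂} [Category.{v₂} K] [MonoidalCategory K] [SymmetricCategory K]
  {G : V ⥤ K} [G.LaxBraided] {P : ObjectProperty K} [IsStrictMonoidalSubcategory P]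
  {C : Type u₃} [EnrichedCategory V C]

/-- The map `ρ ≫ k ≫ λ⁻¹ : A ⊗ I ⟶ I ⊗ B`. -/
@[simps!]
def unitorsConj {A B : K} (k : A ≅ B) : A ⊗ 𝟙_ K ≅ 𝟙_ K ⊗ B :=
  ρ_ A ≪≫ k ≪≫ (λ_ B).symm

/-- Composing with a component on either side tensors the parameter space with `I`. Removing these
factors by unitors leaves `w`, which is `V`-naturality applied to the arrow of the 1-cell. -/
theorem unitorsConj_arr {X X' Y Y' : C} {f : Cell₁ G P X X'} {g : Cell₁ G P Y Y'}
    (x : 𝟙_ V ⟶ (X ⟶[V] Y)) (x' : 𝟙_ V ⟶ (X' ⟶[V] Y')) (k : f.dom ≅ g.dom)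
    (w : k.hom ≫ g.arr ≫ G.map (elemComp x (𝟙 (Y ⟶[V] Y'))) =
      f.arr ≫ G.map (compElem (𝟙 (X ⟶[V] X')) x')) :
    (unitorsConj k).hom ≫ Cell₁.arr (X := X) (Y := Y') (elemCell G P x ≫ g) =
      Cell₁.arr (X := X) (Y := Y') (f ≫ elemCell G P x') := by
  rw [arr_comp, arr_comp]
  refine Eq.trans (congrArg ((unitorsConj k).hom ≫ ·) (elem_tensor_μ_map G x g.arr _))
    (Eq.trans ?_ (tensor_elem_μ_map G f.arr x' _).symm)
  simp only [elemComp, compElem, tensorHom_id, id_tensorHom] at w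
  change ((ρ_ f.dom).hom ≫ k.hom ≫ (λ_ g.dom).inv) ≫ (λ_ g.dom).hom ≫ _ = _
  rw [Category.assoc, Category.assoc, Iso.inv_hom_id_assoc, w]

theorem unitorsConj_mapId {A B : K} {k : A ⟶ B} {m : A ⟶ 𝟙_ K} {m' : B ⟶ 𝟙_ K} (h : k ≫ m' = m) :
    ((ρ_ A).hom ≫ k ≫ (λ_ B).inv) ≫ 𝟙_ K ◁ m' =
      m ▷ 𝟙_ K ≫ (λ_ (𝟙_ K)).hom ≫ (ρ_ (𝟙_ K)).inv := by
  subst h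
  simp [unitors_equal, unitors_inv_equal]

theorem reparam_associator_inv {X Y Z X' : C} (f : Cell₁ G P X Y) (g : Cell₁ G P Y Z)
    (h : Cell₁ G P Z X') :
    Cell₁.reparam (X := X) (Y := X') (Bicategory.associator f g h).inv =
      (MonoidalCategory.associator f.dom g.dom h.dom).inv :=
  (isEqToHom_reparam (X := X) (Y := X') (Category.assoc f g h).symm).unique
    ((IsEqToHom.associator f.dom_mem g.dom_mem h.dom_mem).inv (Iso.hom_inv_id _))

theorem reparam_leftUnitor_inv {X Y : C} (f : Cell₁ G P X Y) :
    Cell₁.reparam (X := X) (Y := Y) (Bicategory.leftUnitor f).inv =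
      (MonoidalCategory.leftUnitor f.dom).inv :=
  (isEqToHom_reparam (X := X) (Y := Y) (Category.id_comp f).symm).unique
    ((IsEqToHom.leftUnitor f.dom_mem).inv (Iso.hom_inv_id _))

theorem reparam_rightUnitor_inv {X Y : C} (f : Cell₁ G P X Y) :
    Cell₁.reparam (X := X) (Y := Y) (Bicategory.rightUnitor f).inv =
      (MonoidalCategory.rightUnitor f.dom).inv :=
  (isEqToHom_reparam (X := X) (Y := Y) (Category.comp_id f).symm).unique
    ((IsEqToHom.rightUnitor f.dom_mem).inv (Iso.hom_inv_id _))

variable {B : Type u₄} [Bicategory.{w₄, v₄} B] {Q R : Pseudofunctor B (ParamCat G P C)}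

/-- A strong transformation whose components are global elements of the hom objects of `C`. -/
def elemTrans
    (x : ∀ b, 𝟙_ V ⟶ EnrichedCategory.Hom (V := V) (C := C) (Q.obj b) (R.obj b))
    (k : ∀ {b c : B} (f : b ⟶ c), Cell₁.dom (C := C) (Q.map f) ≅ Cell₁.dom (C := C) (R.map f))
    (w : ∀ {b c : B} (f : b ⟶ c), (k f).hom ≫ Cell₁.arr (C := C) (R.map f) ≫
        G.map (elemComp (C := C) (x b) (𝟙 _)) =
      Cell₁.arr (C := C) (Q.map f) ≫ G.map (compElem (C := C) (𝟙 _) (x c)))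
    (natural : ∀ {b c : B} {f g : b ⟶ c} (η : f ⟶ g),
      Cell₁.reparam (C := C) (Q.map₂ η) ≫ (k g).hom =
        (k f).hom ≫ Cell₁.reparam (C := C) (R.map₂ η))
    (mapId : ∀ b : B, (k (𝟙 b)).hom ≫ Cell₁.reparam (C := C) (R.mapId b).hom =
      Cell₁.reparam (C := C) (Q.mapId b).hom)
    (mapComp : ∀ {b c d : B} (f : b ⟶ c) (g : c ⟶ d),
      (k (f ≫ g)).hom ≫ Cell₁.reparam (C := C) (R.mapComp f g).hom =
        Cell₁.reparam (C := C) (Q.mapComp f g).hom ≫ ((k f).hom ⊗ₘ (k g).hom)) :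
    Pseudofunctor.StrongTrans Q R where
  app b := elemCell (C := C) G P (x b)
  naturality {b c} f := cellIso (C := C) (X := Q.obj b) (Y := R.obj c) (unitorsConj (k f))
    (unitorsConj_arr (C := C) (x b) (x c) (k f) (w f))
  naturality_naturality {b c _ _} η := reparam_injective (C := C) (X := Q.obj b) (Y := R.obj c)
    (Eq.trans (reparam_comp_congr (C := C)
      (reparam_whiskerRight_congr (C := C) (elemCell (C := C) G P (x c)) rfl) rfl)
    (Eq.trans (unitors_conj_naturality (natural η)) (Eq.symm
    (reparam_comp_congr (C := C) rfl
      (reparam_whiskerLeft_congr (C := C) (elemCell (C := C) G P (x b)) rfl)))))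
  naturality_id b := reparam_injective (C := C) (X := Q.obj b) (Y := R.obj b)
    (Eq.trans (reparam_comp_congr (C := C) rfl
      (reparam_whiskerLeft_congr (C := C) (elemCell (C := C) G P (x b)) rfl))
    (Eq.trans (unitorsConj_mapId (mapId b)) (Eq.symm
    (reparam_comp_congr (C := C)
      (reparam_whiskerRight_congr (C := C) (elemCell (C := C) G P (x b)) rfl)
      (reparam_comp_congr (C := C) (reparam_leftUnitor (C := C) (elemCell (C := C) G P (x b)))
        (reparam_rightUnitor_inv (C := C) (elemCell (C := C) G P (x b))))))))
  naturality_comp {b c d} f g := reparam_injective (C := C) (X := Q.obj b) (Y := R.obj d)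
    (Eq.trans (reparam_comp_congr (C := C) rfl
      (reparam_whiskerLeft_congr (C := C) (elemCell (C := C) G P (x b)) rfl))
    (Eq.trans (unitors_conj_comp (mapComp f g)) (Eq.symm
    (reparam_comp_congr (C := C)
      (reparam_whiskerRight_congr (C := C) (elemCell (C := C) G P (x d)) rfl)
      (reparam_comp_congr (C := C) (reparam_associator (C := C) (Q.map f) (Q.map g)
        (elemCell (C := C) G P (x d)))
      (reparam_comp_congr (C := C) (reparam_whiskerLeft_congr (C := C) (Q.map f) rfl)
      (reparam_comp_congr (C := C) (reparam_associator_inv (C := C) (Q.map f)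
        (elemCell (C := C) G P (x c)) (R.map g))
      (reparam_comp_congr (C := C) (reparam_whiskerRight_congr (C := C) (R.map g) rfl)
      (reparam_associator (C := C) (elemCell (C := C) G P (x b)) (R.map f) (R.map g))))))))))

end ElemTrans

/-! ### Associator, unitors and symmetry of the product. -/

section Coherence

variable {V : Type u₁} [Category.{v₁} V] [MonoidalCategory V] [SymmetricCategory V]
  {K : Type u₂} [Category.{v₂} K] [MonoidalCategory K] [SymmetricCategory K]
  (G : V ⥤ K) [G.LaxBraided] (P : ObjectProperty K) [IsStrictMonoidalSubcategory P]
  {C : Type u₃} [EnrichedCategory V C] (T : MonoidalEnrichedCategory V C)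

/-- Composition with a fixed global element is post-composition with one arrow of hom objects. In
this form the `V`-naturality axioms can be carried along `G`. -/
theorem elemComp_eq {S : V} {X Y Z : C} (x : 𝟙_ V ⟶ (X ⟶[V] Y)) (y : S ⟶ (Y ⟶[V] Z)) :
    elemComp x y = y ≫ elemComp x (𝟙 (Y ⟶[V] Z)) := by
  simp only [elemComp, MonoidalCategory.tensorHom_def', Category.assoc, whiskerLeft_id,
    Category.id_comp,
    leftUnitor_inv_naturality_assoc]

theorem compElem_eq {S : V} {X Y Z : C} (y : S ⟶ (X ⟶[V] Y)) (x : 𝟙_ V ⟶ (Y ⟶[V] Z)) :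
    compElem y x = y ≫ compElem (𝟙 (X ⟶[V] Y)) x := by
  simp only [compElem, MonoidalCategory.tensorHom_def, Category.assoc, id_whiskerRight,
    Category.id_comp,
    rightUnitor_inv_naturality_assoc]

/-- `V`-naturality of `a` produces an associator in `V`, which the associativity law of `G`
exchanges for the one on parameter spaces. -/
theorem associator_arr {X X' Y Y' Z Z' : C} (f : Cell₁ G P X X') (g : Cell₁ G P Y Y')
    (h : Cell₁ G P Z Z') :
    (α_ f.dom g.dom h.dom).hom ≫ (tensorCell₁ G P T f (tensorCell₁ G P T g h)).arr ≫
        G.map (elemComp (T.a X Y Z) (𝟙 _)) =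
      (tensorCell₁ G P T (tensorCell₁ G P T f g) h).arr ≫
        G.map (compElem (𝟙 _) (T.a X' Y' Z')) := by
  rw [arr_tensorCell₁, arr_tensorCell₁, arr_tensorCell₁, arr_tensorCell₁]
  change (α_ f.dom g.dom h.dom).hom ≫ ((f.arr ⊗ₘ ((g.arr ⊗ₘ h.arr) ≫ μ G _ _ ≫
      G.map (T.hom Y Y' Z Z'))) ≫ μ G _ _ ≫ G.map (T.hom X X' (T.obj Y Z) (T.obj Y' Z'))) ≫
      G.map (elemComp (T.a X Y Z) (𝟙 _)) =
    ((((f.arr ⊗ₘ g.arr) ≫ μ G _ _ ≫ G.map (T.hom X X' Y Y')) ⊗ₘ h.arr) ≫ μ G _ _ ≫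
      G.map (T.hom (T.obj X Y) (T.obj X' Y') Z Z')) ≫ G.map (compElem (𝟙 _) (T.a X' Y' Z'))
  have h1 := tensor_map_right_μ_map G f.arr ((g.arr ⊗ₘ h.arr) ≫ μ G _ _) (T.hom Y Y' Z Z')
    (T.hom X X' (T.obj Y Z) (T.obj Y' Z') ≫ elemComp (T.a X Y Z) (𝟙 _))
  have h2 := tensor_map_left_μ_map G ((f.arr ⊗ₘ g.arr) ≫ μ G _ _) h.arr (T.hom X X' Y Y')
    (T.hom (T.obj X Y) (T.obj X' Y') Z Z' ≫ compElem (𝟙 _) (T.a X' Y' Z'))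
  have e := T.a_natural X Y Z X' Y' Z'
  rw [compElem_eq, elemComp_eq, Category.assoc, Category.assoc, Category.assoc] at e
  rw [e, G.map_comp (α_ _ _ _).hom] at h2
  simp only [Category.assoc, G.map_comp] at h1 h2 ⊢
  refine Eq.trans (congrArg ((α_ f.dom g.dom h.dom).hom ≫ ·) h1) (Eq.trans ?_ h2.symm)
  have e1 : (f.arr ⊗ₘ ((g.arr ⊗ₘ h.arr) ≫ μ G _ _)) = (f.arr ⊗ₘ (g.arr ⊗ₘ h.arr)) ≫ _ ◁ μ G _ _ := by
    rw [← id_tensorHom, tensorHom_comp_tensorHom, Category.comp_id]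
  have e2 : (((f.arr ⊗ₘ g.arr) ≫ μ G _ _) ⊗ₘ h.arr) = ((f.arr ⊗ₘ g.arr) ⊗ₘ h.arr) ≫ μ G _ _ ▷ _ := by
    rw [← tensorHom_id, tensorHom_comp_tensorHom, Category.comp_id]
  have a1 := Functor.LaxMonoidal.associativity G (X ⟶[V] X') (Y ⟶[V] Y') (Z ⟶[V] Z')
  rw [e1, e2, Category.assoc, Category.assoc, reassoc_of% a1, associator_naturality_assoc]

theorem leftUnitor_arr {X X' : C} (f : Cell₁ G P X X') :
    (λ_ f.dom).hom ≫ f.arr ≫ G.map (elemComp (T.l X) (𝟙 _)) =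
      (tensorCell₁ G P T (𝟙 (zeroCell G P T.J)) f).arr ≫ G.map (compElem (𝟙 _) (T.l X')) := by
  rw [arr_tensorCell₁]
  refine Eq.trans ?_ (congrArg (fun x => ((x ⊗ₘ f.arr) ≫ μ G _ _ ≫ G.map (T.hom T.J T.J X X')) ≫
    G.map (compElem (𝟙 _) (T.l X'))) (arr_id G P T.J)).symm
  have h := elem_tensor_μ_map G (eId V T.J) f.arr
    (T.hom T.J T.J X X' ≫ compElem (𝟙 _) (T.l X'))
  have e := T.l_natural X X'
  rw [compElem_eq, Category.assoc, Category.assoc] at e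
  rw [e] at h
  rw [Category.assoc, Category.assoc, ← G.map_comp]
  exact h.symm

theorem rightUnitor_arr {X X' : C} (f : Cell₁ G P X X') :
    (ρ_ f.dom).hom ≫ f.arr ≫ G.map (elemComp (T.r X) (𝟙 _)) =
      (tensorCell₁ G P T f (𝟙 (zeroCell G P T.J))).arr ≫ G.map (compElem (𝟙 _) (T.r X')) := by
  rw [arr_tensorCell₁]
  refine Eq.trans ?_ (congrArg (fun x => ((f.arr ⊗ₘ x) ≫ μ G _ _ ≫ G.map (T.hom X X' T.J T.J)) ≫
    G.map (compElem (𝟙 _) (T.r X'))) (arr_id G P T.J)).symm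
  have h := tensor_elem_μ_map G f.arr (eId V T.J)
    (T.hom X X' T.J T.J ≫ compElem (𝟙 _) (T.r X'))
  have e := T.r_natural X X'
  rw [compElem_eq, Category.assoc, Category.assoc] at e
  rw [e] at h
  rw [Category.assoc, Category.assoc, ← G.map_comp]
  exact h.symm

/-- `V`-naturality of `s` produces a braiding in `V`; `G` being braided moves it to the parameter
spaces. -/
theorem braiding_arr (S : SymmetricEnrichedCategory T) {X X' Y Y' : C} (f : Cell₁ G P X X')
    (g : Cell₁ G P Y Y') :
    (β_ f.dom g.dom).hom ≫ (tensorCell₁ G P T g f).arr ≫ G.map (elemComp (S.s X Y) (𝟙 _)) =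
      (tensorCell₁ G P T f g).arr ≫ G.map (compElem (𝟙 _) (S.s X' Y')) := by
  rw [arr_tensorCell₁, arr_tensorCell₁]
  change (β_ f.dom g.dom).hom ≫ ((g.arr ⊗ₘ f.arr) ≫ μ G _ _ ≫ G.map (T.hom Y Y' X X')) ≫
      G.map (elemComp (S.s X Y) (𝟙 _)) =
    ((f.arr ⊗ₘ g.arr) ≫ μ G _ _ ≫ G.map (T.hom X X' Y Y')) ≫ G.map (compElem (𝟙 _) (S.s X' Y'))
  have e := S.s_natural X Y X' Y'
  rw [compElem_eq, elemComp_eq, Category.assoc] at e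
  rw [Category.assoc, Category.assoc, Category.assoc, Category.assoc, ← G.map_comp, ← G.map_comp, e,
    G.map_comp (β_ _ _).hom, ← Category.assoc (μ G _ _) (G.map (β_ _ _).hom),
    Functor.LaxBraided.braided, Category.assoc, BraidedCategory.braiding_naturality_assoc]

/-- The monoidal product of `(P/G)_* C`. -/
abbrev tensorPseudofunctor : Pseudofunctor (ParamCat G P C × ParamCat G P C) (ParamCat G P C) :=
  (tensorStructure G P T).toPseudofunctor

theorem isIdentityCell_tensorStructure_mapId (X : ParamCat G P C × ParamCat G P C) :
    IsIdentityCell ((tensorStructure G P T).mapId X).hom :=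
  isIdentityCell_of_reparam (C := C) (X := T.obj X.1 X.2) (Y := T.obj X.1 X.2)
    (IsEqToHom.leftUnitor (P := P) P.prop_unit)

theorem id_tensor_leftUnitor {A B : K} (a : A ⟶ B) :
    (𝟙 (𝟙_ K) ⊗ₘ a) ≫ (λ_ B).hom = (λ_ A).hom ≫ a := by
  simp

theorem tensor_id_rightUnitor {A B : K} (a : A ⟶ B) :
    (a ⊗ₘ 𝟙 (𝟙_ K)) ≫ (ρ_ B).hom = (ρ_ A).hom ≫ a := by
  simp

/-- The inverse unitor at `I` is the comparison of `𝟙 J` with `𝟙 J ≫ 𝟙 J` contributed by fixing the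
first argument of the product at `J`. -/
theorem leftUnitor_tensorδ (A B : K) :
    (λ_ (A ⊗ B)).hom = (((ρ_ (𝟙_ K)).inv ⊗ₘ 𝟙 (A ⊗ B)) ≫ tensorδ (𝟙_ K) A (𝟙_ K) B) ≫
      ((λ_ A).hom ⊗ₘ (λ_ B).hom) := by
  rw [leftUnitor_monoidal, Category.assoc, tensorδ_tensorμ_assoc, tensorHom_id, unitors_inv_equal.symm,
    ← comp_whiskerRight_assoc, Iso.inv_hom_id, id_whiskerRight, Category.id_comp]

theorem rightUnitor_tensorδ (A B : K) :
    (ρ_ (A ⊗ B)).hom = ((𝟙 (A ⊗ B) ⊗ₘ (λ_ (𝟙_ K)).inv) ≫ tensorδ A (𝟙_ K) B (𝟙_ K)) ≫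
      ((ρ_ A).hom ⊗ₘ (ρ_ B).hom) := by
  rw [rightUnitor_monoidal, Category.assoc, tensorδ_tensorμ_assoc, id_tensorHom,
    ← whiskerLeft_comp_assoc, Iso.inv_hom_id, whiskerLeft_id, Category.id_comp]

theorem id_tensor_id_comp {A B D : K} (m : A ⊗ B ⟶ D) : (𝟙 A ⊗ₘ 𝟙 B) ≫ m = m := by
  rw [id_tensorHom_id, Category.id_comp]

/-- The identity factors are the trivial comparisons that arise when the two triple products are
formed as composite pseudofunctors. -/
theorem associator_tensorHom_tensorδ (X₁ X₂ X₃ Y₁ Y₂ Y₃ : K) :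
    (α_ (X₁ ⊗ Y₁) (X₂ ⊗ Y₂) (X₃ ⊗ Y₃)).hom ≫ (𝟙 _ ⊗ₘ (𝟙 _ ⊗ₘ 𝟙 _)) ≫
        (𝟙 (X₁ ⊗ Y₁) ⊗ₘ tensorδ X₂ X₃ Y₂ Y₃) ≫ tensorδ X₁ (X₂ ⊗ X₃) Y₁ (Y₂ ⊗ Y₃) =
      ((tensorδ X₁ X₂ Y₁ Y₂ ⊗ₘ 𝟙 (X₃ ⊗ Y₃)) ≫ tensorδ (X₁ ⊗ X₂) X₃ (Y₁ ⊗ Y₂) Y₃) ≫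
        ((α_ X₁ X₂ X₃).hom ⊗ₘ (α_ Y₁ Y₂ Y₃).hom) := by
  rw [id_tensorHom_id, id_tensor_id_comp, id_tensorHom, tensorHom_id, associator_tensorδ,
    Category.assoc]

/-- The associator. -/
def associatorTrans : Pseudofunctor.StrongTrans (tensorLeft (tensorPseudofunctor G P T))
    (tensorRight (tensorPseudofunctor G P T)) :=
  elemTrans (fun X => T.a X.1.1 X.1.2 X.2)
    (fun f => α_ (Cell₁.dom (C := C) f.1.1) (Cell₁.dom (C := C) f.1.2) (Cell₁.dom (C := C) f.2))
    (fun f => associator_arr (C := C) G P T f.1.1 f.1.2 f.2)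
    (fun η => associator_naturality _ _ _)
    (fun X => by
      -- Every arrow in the unit law is a transported identity between tensor powers of `I`, so the
      -- two sides agree by uniqueness.
      have hI : P (𝟙_ K) := P.prop_unit
      have hl := IsEqToHom.leftUnitor hI
      refine IsEqToHom.unique ((IsEqToHom.associator hI hI hI).comp ?_) ?_
      · change IsEqToHom ((𝟙 _ ⊗ₘ (𝟙 _ ⊗ₘ 𝟙 _)) ≫ (𝟙 _ ⊗ₘ (λ_ (𝟙_ K)).hom) ≫ (λ_ (𝟙_ K)).hom)
        exact (IsEqToHom.tensor (.id _) (.tensor (.id _) (.id _))).comp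
          ((IsEqToHom.tensor (.id _) hl).comp hl)
      · change IsEqToHom (((λ_ (𝟙_ K)).hom ⊗ₘ 𝟙 _) ≫ (λ_ (𝟙_ K)).hom)
        exact (IsEqToHom.tensor hl (.id _)).comp hl)
    (fun f g => by
      exact associator_tensorHom_tensorδ _ _ _ _ _ _)

/-- The left unitor. -/
def leftUnitorTrans : Pseudofunctor.StrongTrans
    (unitTensor (tensorPseudofunctor G P T) (zeroCell G P T.J)) (Pseudofunctor.id _) :=
  elemTrans (fun X => T.l X)
    (fun f => λ_ (Cell₁.dom (C := C) f))
    (fun f => leftUnitor_arr (C := C) G P T f)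
    (fun η => id_tensor_leftUnitor _)
    (fun X => by
      change (λ_ (𝟙_ K)).hom ≫ 𝟙 _ = (𝟙 _ ⊗ₘ 𝟙 _) ≫ (λ_ (𝟙_ K)).hom
      simp)
    (fun f g => by
      refine (Category.comp_id _).trans ?_
      refine Eq.trans ?_ (congrArg (· ≫ _) (reparam_comp_congr (C := C) (reparam_tensor_congr
        (C := C) T (reparam_rightUnitor_inv (C := C) (𝟙 (zeroCell G P T.J))) rfl) rfl)).symm
      exact leftUnitor_tensorδ _ _)

/-- The right unitor. -/
def rightUnitorTrans : Pseudofunctor.StrongTrans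
    (tensorUnit (tensorPseudofunctor G P T) (zeroCell G P T.J)) (Pseudofunctor.id _) :=
  elemTrans (fun X => T.r X)
    (fun f => ρ_ (Cell₁.dom (C := C) f))
    (fun f => rightUnitor_arr (C := C) G P T f)
    (fun η => tensor_id_rightUnitor _)
    (fun X => by
      change (ρ_ (𝟙_ K)).hom ≫ 𝟙 _ = (𝟙 _ ⊗ₘ 𝟙 _) ≫ (λ_ (𝟙_ K)).hom
      simp [unitors_equal])
    (fun f g => by
      refine (Category.comp_id _).trans ?_
      refine Eq.trans ?_ (congrArg (· ≫ _) (reparam_comp_congr (C := C) (reparam_tensor_congr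
        (C := C) T rfl (reparam_leftUnitor_inv (C := C) (𝟙 (zeroCell G P T.J)))) rfl)).symm
      exact rightUnitor_tensorδ _ _)

/-- The symmetry. -/
def braidingTrans (S : SymmetricEnrichedCategory T) : Pseudofunctor.StrongTrans
    (tensorPseudofunctor G P T) (tensorSwap (tensorPseudofunctor G P T)) :=
  elemTrans (fun X => S.s X.1 X.2)
    (fun f => β_ (Cell₁.dom (C := C) f.1) (Cell₁.dom (C := C) f.2))
    (fun f => braiding_arr (C := C) G P T S f.1 f.2)
    (fun η => BraidedCategory.braiding_naturality _ _)
    (fun X => by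
      change (β_ (𝟙_ K) (𝟙_ K)).hom ≫ (𝟙 _ ⊗ₘ 𝟙 _) ≫ (λ_ (𝟙_ K)).hom = (λ_ (𝟙_ K)).hom
      rw [id_tensor_id_comp, braiding_leftUnitor, unitors_equal])
    (fun f g => by
      refine Eq.trans ?_ (tensorδ_braiding _ _ _ _)
      refine congrArg (_ ≫ ·) ?_
      exact id_tensor_id_comp _)

theorem isEqToHom_unitorsConj {A B : K} (hA : P A) (hB : P B) {k : A ≅ B}
    (hk : IsEqToHom k.hom) : IsEqToHom (unitorsConj k).hom :=
  (IsEqToHom.rightUnitor hA).comp (hk.comp ((IsEqToHom.leftUnitor hB).inv (Iso.hom_inv_id _)))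

/-- The source of strict 2-naturality: unitors at objects of `P` are identities, so only `k` could
make the naturality 2-cell nontrivial. -/
theorem isIdentityCell_unitorsConj {X X' Y Y' : C} {f : Cell₁ G P X X'} {g : Cell₁ G P Y Y'}
    {x : 𝟙_ V ⟶ (X ⟶[V] Y)} {x' : 𝟙_ V ⟶ (X' ⟶[V] Y')} {k : f.dom ≅ g.dom}
    (hk : IsEqToHom k.hom)
    {φ : f ≫ elemCell G P x' ⟶ elemCell G P x ≫ g}
    (h : Cell₁.reparam (X := X) (Y := Y') φ = (unitorsConj k).hom) : IsIdentityCell φ := by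
  refine isIdentityCell_of_reparam (C := C) (X := X) (Y := Y') ?_
  have e := isEqToHom_unitorsConj P f.dom_mem g.dom_mem hk
  rw [← h] at e
  exact e

theorem tensorCell₁_elemCell_id {X Y : C} (x : 𝟙_ V ⟶ (X ⟶[V] Y)) (Z : C) :
    tensorCell₁ G P T (elemCell G P x) (𝟙 (zeroCell G P Z)) =
      elemCell G P ((λ_ (𝟙_ V)).inv ≫ (x ⊗ₘ eId V Z) ≫ T.hom X Y Z Z) :=
  (congrArg (tensorCell₁ G P T (elemCell G P x)) (id_eq_elemCell G P Z)).trans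
    (tensorCell₁_elemCell G P T x (eId V Z))

theorem tensorCell₁_id_elemCell {X Y : C} (Z : C) (x : 𝟙_ V ⟶ (X ⟶[V] Y)) :
    tensorCell₁ G P T (𝟙 (zeroCell G P Z)) (elemCell G P x) =
      elemCell G P ((λ_ (𝟙_ V)).inv ≫ (eId V Z ⊗ₘ x) ≫ T.hom Z Z X Y) :=
  (congrArg (tensorCell₁ G P T · (elemCell G P x)) (id_eq_elemCell G P Z)).trans
    (tensorCell₁_elemCell G P T (eId V Z) x)

/-- Composition of 1-cells, with objects of `C` as 0-cells. -/
abbrev compCell {X Y Z : C} (f : Cell₁ G P X Y) (g : Cell₁ G P Y Z) : Cell₁ G P X Z := f ≫ g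

variable {G P} in
theorem compCell_elemCell {X Y Z : C} {f : Cell₁ G P X Y} {g : Cell₁ G P Y Z}
    {x : 𝟙_ V ⟶ (X ⟶[V] Y)} {y : 𝟙_ V ⟶ (Y ⟶[V] Z)} (hf : f = elemCell G P x)
    (hg : g = elemCell G P y) : compCell G P f g = elemCell G P (elemComp x y) := by
  subst hf hg
  exact elemCell_comp G P x y

/-- The nearly strict monoidal structure of `(P/G)_* C`. -/
def nearlyStrictMonoidal :
    NearlyStrictMonoidal (tensorPseudofunctor G P T) (zeroCell G P T.J) where
  a := associatorTrans G P T
  a_strict _ _ f := isIdentityCell_unitorsConj (C := C) G P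
    (f := (tensorLeft (tensorPseudofunctor G P T)).map f)
    (g := (tensorRight (tensorPseudofunctor G P T)).map f)
    (IsEqToHom.associator (Cell₁.dom_mem (C := C) f.1.1)
      (Cell₁.dom_mem (C := C) f.1.2) (Cell₁.dom_mem (C := C) f.2)) rfl
  a_invertible X := isInvertible_elemCell (C := C) G P _ _ (T.a_aInv X.1.1 X.1.2 X.2)
    (T.aInv_a X.1.1 X.1.2 X.2)
  l := leftUnitorTrans G P T
  l_strict _ _ f := isIdentityCell_unitorsConj (C := C) G P
    (f := (unitTensor (tensorPseudofunctor G P T) (zeroCell G P T.J)).map f) (g := f)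
    (IsEqToHom.leftUnitor (Cell₁.dom_mem (C := C) f)) rfl
  l_invertible X := isInvertible_elemCell (C := C) G P _ _ (T.l_lInv X) (T.lInv_l X)
  r := rightUnitorTrans G P T
  r_strict _ _ f := isIdentityCell_unitorsConj (C := C) G P
    (f := (tensorUnit (tensorPseudofunctor G P T) (zeroCell G P T.J)).map f) (g := f)
    (IsEqToHom.rightUnitor (Cell₁.dom_mem (C := C) f)) rfl
  r_invertible X := isInvertible_elemCell (C := C) G P _ _ (T.r_rInv X) (T.rInv_r X)
  pentagon W X Y Z :=
    Eq.trans (compCell_elemCell (C := C) (tensorCell₁_elemCell_id (C := C) G P T (T.a W X Y) Z)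
      (compCell_elemCell (C := C) rfl (tensorCell₁_id_elemCell (C := C) G P T W (T.a X Y Z))))
    (Eq.trans (congrArg (elemCell G P) (T.pentagon W X Y Z))
      (Eq.symm (compCell_elemCell (C := C) rfl rfl)))
  triangle X Y :=
    Eq.trans (compCell_elemCell (C := C) rfl (tensorCell₁_id_elemCell (C := C) G P T X (T.l Y)))
    (Eq.trans (congrArg (elemCell G P) (T.triangle X Y))
      (Eq.symm (tensorCell₁_elemCell_id (C := C) G P T (T.r X) Y)))

/-- The symmetry of `(P/G)_* C`. -/
def nearlyStrictSymmetric (S : SymmetricEnrichedCategory T) :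
    NearlyStrictSymmetric (nearlyStrictMonoidal G P T) where
  s := braidingTrans G P T S
  s_s X Y := Eq.trans (compCell_elemCell (C := C) rfl rfl)
    (Eq.trans (congrArg (elemCell G P) (S.s_s X Y))
      (Eq.symm (id_eq_elemCell (C := C) G P (T.obj X Y))))
  hexagon X Y Z :=
    Eq.trans (compCell_elemCell (C := C) (tensorCell₁_elemCell_id (C := C) G P T (S.s X Y) Z)
      (compCell_elemCell (C := C) rfl (tensorCell₁_id_elemCell (C := C) G P T Y (S.s X Z))))
    (Eq.trans (congrArg (elemCell G P) (S.hexagon X Y Z))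
      (Eq.symm (compCell_elemCell (C := C) rfl (compCell_elemCell (C := C) rfl rfl))))
  unit X := Eq.trans (compCell_elemCell (C := C) rfl rfl) (congrArg (elemCell G P) (S.unit X))

end Coherence

/-! ### Comparison maps of the composite of `F` with the Kleisli functor. -/

section Kleisli

variable {V : Type u₁} [Category.{v₁} V] [MonoidalCategory V]
  {W : Type u₂} [Category.{v₂} W] [MonoidalCategory W] [SymmetricCategory W]
  (F : V ⥤ W) [F.LaxMonoidal] (M : Monad W) [SymmetricMonoidalMonad M]

/-- The comparison maps of the Kleisli functor are identities, so only those of `F` survive; this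
gives the explicit formulas of the theorem. -/
theorem toKleisli_ε_map {A : V} (x : 𝟙_ V ⟶ A) :
    ε (F ⋙ Kleisli.Adjunction.toKleisli M) ≫ (F ⋙ Kleisli.Adjunction.toKleisli M).map x =
      (Kleisli.Adjunction.toKleisli M).map (ε F ≫ F.map x) := by
  change (𝟙 _ ≫ (Kleisli.Adjunction.toKleisli M).map (ε F)) ≫
    (Kleisli.Adjunction.toKleisli M).map (F.map x) = _
  rw [Category.id_comp, ← Functor.map_comp]

theorem toKleisli_μ_map {A B D : V} (x : A ⊗ B ⟶ D) :
    μ (F ⋙ Kleisli.Adjunction.toKleisli M) A B ≫ (F ⋙ Kleisli.Adjunction.toKleisli M).map x =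
      (Kleisli.Adjunction.toKleisli M).map (μ F A B ≫ F.map x) := by
  change (𝟙 _ ≫ (Kleisli.Adjunction.toKleisli M).map (μ F A B)) ≫
    (Kleisli.Adjunction.toKleisli M).map (F.map x) = _
  rw [Category.id_comp, ← Functor.map_comp]

end Kleisli

/-! ### Explicit forms of 1-cells and of horizontal composition. -/

section Cells

variable {V : Type u₁} [Category.{v₁} V] [MonoidalCategory V] [SymmetricCategory V]
  {K : Type u₂} [Category.{v₂} K] [MonoidalCategory K] [SymmetricCategory K]
  {G : V ⥤ K} [G.LaxMonoidal] {P : ObjectProperty K} [IsStrictMonoidalSubcategory P]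
  {C : Type u₃} [EnrichedCategory V C]

theorem Cell₁.ext_of_arr {X Y : C} {f : Cell₁ G P X Y} {U : K} {hU : P U}
    {u : U ⟶ G.obj (X ⟶[V] Y)} (h : f.dom = U) (w : eqToHom h ≫ u = f.arr) :
    f = Cell₁.mk G P X Y U hU u :=
  Cell₁.ext_of_isEqToHom (IsEqToHom.eqToHom' h) w

theorem reparam_hComp {X Y Z : C} {f f' : Cell₁ G P X Y} {g g' : Cell₁ G P Y Z} (φ : f ⟶ f')
    (ψ : g ⟶ g') :
    Cell₁.reparam (X := X) (Y := Z) (Bicategory.whiskerRight φ g ≫ Bicategory.whiskerLeft f' ψ) =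
      (Cell₁.reparam φ ⊗ₘ Cell₁.reparam ψ : f.dom ⊗ g.dom ⟶ f'.dom ⊗ g'.dom) := by
  rw [MonoidalCategory.tensorHom_def]
  exact congrArg₂ (· ≫ ·) (reparam_whiskerRight φ g) (reparam_whiskerLeft f' ψ)

end Cells

end ParamUncertainty

/-! ### Assembly over the Kleisli category. -/

theorem theorem3p12
    {V : Type u₁} [Category.{v₁} V] [MonoidalCategory V] [SymmetricCategory V]
    {W : Type u₂} [Category.{v₂} W] [MonoidalCategory W] [SymmetricCategory W]
    (F : V ⥤ W) [F.LaxBraided] (M : Monad W) [SymmetricMonoidalMonad M]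
    (𝒰 : ObjectProperty W) [IsStrictMonoidalSubcategory (kleisliObjects M 𝒰)]
    (C : Type u₃) [EnrichedCategory V C] :
    let L := Kleisli.Adjunction.toKleisli M
    let G := F ⋙ L
    let P := kleisliObjects M 𝒰
    -- the 0-cells are the objects of `C`, and the structure is a strict 2-category
    Function.Bijective (zeroCell G P : C → ParamCat G P C) ∧
    Bicategory.Strict (ParamCat G P C) ∧
    -- the 1-cells
    (∀ X Y : C, Function.Bijective
      (fun f : Cell₁ G P X Y =>
        (⟨⟨f.dom.of, f.dom_mem⟩, f.arr⟩ :
          Σ U : {U : W // 𝒰 U}, L.obj U.1 ⟶ L.obj (F.obj (X ⟶[V] Y))))) ∧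
    -- the 2-cells and their vertical composition
    (∀ (X Y : C) (f g : Cell₁ G P X Y),
      Function.Injective (fun φ : f ⟶ g => Cell₁.reparam φ) ∧
      Set.range (fun φ : f ⟶ g => Cell₁.reparam φ) = {φ | φ ≫ g.arr = f.arr}) ∧
    (∀ (X Y : C) (f g h : Cell₁ G P X Y) (φ : f ⟶ g) (ψ : g ⟶ h),
      Cell₁.reparam (φ ≫ ψ) = Cell₁.reparam φ ≫ Cell₁.reparam ψ) ∧
    (∀ (X Y : C) (f : Cell₁ G P X Y), Cell₁.reparam (𝟙 f) = 𝟙 f.dom) ∧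
    -- horizontal composition and identity 1-cells
    (∀ (X Y Z : C) (f : Cell₁ G P X Y) (g : Cell₁ G P Y Z),
      f ≫ g = Cell₁.mk G P X Z (f.dom ⊗ g.dom) (P.prop_tensor f.dom_mem g.dom_mem)
        ((f.arr ⊗ₘ g.arr) ≫
          L.map (μ F (X ⟶[V] Y) (Y ⟶[V] Z) ≫ F.map (eComp V X Y Z)))) ∧
    (∀ (X Y Z : C) (f f' : Cell₁ G P X Y) (g g' : Cell₁ G P Y Z) (φ : f ⟶ f') (ψ : g ⟶ g'),
      Cell₁.reparam (Bicategory.whiskerRight φ g ≫ Bicategory.whiskerLeft f' ψ) =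
        (Cell₁.reparam φ ⊗ₘ Cell₁.reparam ψ : f.dom ⊗ g.dom ⟶ f'.dom ⊗ g'.dom)) ∧
    (∀ X : C, 𝟙 (zeroCell G P X) =
      Cell₁.mk G P X X (𝟙_ (Kleisli M)) P.prop_unit (L.map (ε F ≫ F.map (eId V X)))) ∧
    -- the nearly strict (symmetric) monoidal structure
    ∀ T : MonoidalEnrichedCategory V C,
      (∀ (X₁ Y₁ X₂ Y₂ : C) (f₁ : Cell₁ G P X₁ Y₁) (f₂ : Cell₁ G P X₂ Y₂),
        (tensorCells G P T).map (Prod.mkHom f₁ f₂) =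
          Cell₁.mk G P (T.obj X₁ X₂) (T.obj Y₁ Y₂) (f₁.dom ⊗ f₂.dom) (P.prop_tensor f₁.dom_mem f₂.dom_mem)
            ((f₁.arr ⊗ₘ f₂.arr) ≫
              L.map (μ F (X₁ ⟶[V] Y₁) (X₂ ⟶[V] Y₂) ≫ F.map (T.hom X₁ Y₁ X₂ Y₂)))) ∧
      (∀ (X₁ Y₁ X₂ Y₂ : C) (f₁ g₁ : Cell₁ G P X₁ Y₁) (f₂ g₂ : Cell₁ G P X₂ Y₂)
          (φ₁ : f₁ ⟶ g₁) (φ₂ : f₂ ⟶ g₂),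
        Cell₁.reparam (X := T.obj X₁ X₂) (Y := T.obj Y₁ Y₂) ((tensorCells G P T).map₂
            (Prod.mkHom φ₁ φ₂ : Prod.mkHom f₁ f₂ ⟶ Prod.mkHom g₁ g₂)) =
          (Cell₁.reparam φ₁ ⊗ₘ Cell₁.reparam φ₂ : f₁.dom ⊗ f₂.dom ⟶ g₁.dom ⊗ g₂.dom)) ∧
      ∃ ϑ : PseudoStructure (tensorCells G P T),
        (∀ X : ParamCat G P C × ParamCat G P C, IsIdentityCell (ϑ.mapId X).hom) ∧
        (∀ (X₁ Y₁ Z₁ X₂ Y₂ Z₂ : C) (f₁ : Cell₁ G P X₁ Y₁) (f₂ : Cell₁ G P X₂ Y₂)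
            (g₁ : Cell₁ G P Y₁ Z₁) (g₂ : Cell₁ G P Y₂ Z₂),
          Cell₁.reparam (X := T.obj X₁ X₂) (Y := T.obj Z₁ Z₂)
            (ϑ.mapComp (Prod.mkHom f₁ f₂) (Prod.mkHom g₁ g₂)).inv =
            tensorμ f₁.dom f₂.dom g₁.dom g₂.dom) ∧
        ∃ N : NearlyStrictMonoidal ϑ.toPseudofunctor (zeroCell G P T.J),
          (∀ X Y Z : C, N.a.app ((X, Y), Z) =
            Cell₁.mk G P (T.obj (T.obj X Y) Z) (T.obj X (T.obj Y Z)) (𝟙_ (Kleisli M)) P.prop_unit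
              (L.map (ε F ≫ F.map (T.a X Y Z)))) ∧
          (∀ X : C, N.l.app X =
            Cell₁.mk G P (T.obj T.J X) X (𝟙_ (Kleisli M)) P.prop_unit
              (L.map (ε F ≫ F.map (T.l X)))) ∧
          (∀ X : C, N.r.app X =
            Cell₁.mk G P (T.obj X T.J) X (𝟙_ (Kleisli M)) P.prop_unit
              (L.map (ε F ≫ F.map (T.r X)))) ∧
          ∀ S : SymmetricEnrichedCategory T, ∃ σ : NearlyStrictSymmetric N,
            (∀ X Y : C, σ.s.app (X, Y) =
              Cell₁.mk G P (T.obj X Y) (T.obj Y X) (𝟙_ (Kleisli M)) P.prop_unit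
              (L.map (ε F ≫ F.map (S.s X Y)))) ∧
            (∀ (X₁ Y₁ X₂ Y₂ : C) (f₁ : Cell₁ G P X₁ Y₁) (f₂ : Cell₁ G P X₂ Y₂),
              ∃ h₁ h₂, Cell₁.reparam (X := T.obj X₁ X₂) (Y := T.obj Y₂ Y₁)
                  (σ.s.naturality (Prod.mkHom f₁ f₂)).hom =
                eqToHom h₁ ≫ (β_ f₁.dom f₂.dom).hom ≫ eqToHom h₂) := by
  intro L G P
  refine ⟨Function.bijective_id, inferInstance, fun X Y => ⟨?_, ?_⟩, fun X Y f g => ⟨?_, ?_⟩,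
    fun _ _ _ _ _ _ _ => rfl, fun _ _ _ => rfl, fun X Y Z f g => ?_,
    fun X Y Z f f' g g' φ ψ => reparam_hComp φ ψ, fun X => ?_, fun T => ⟨?_, ?_, ?_⟩⟩
  · intro f g h
    obtain ⟨⟨U, hU⟩, ⟨⟨⟩⟩, f⟩ := f
    obtain ⟨⟨U', hU'⟩, ⟨⟨⟩⟩, g⟩ := g
    -- Kleisli objects wrap objects of `W`; unwrapping them exposes the equality of dependent pairs
    -- to case analysis.
    obtain ⟨U⟩ := U
    obtain ⟨U'⟩ := U'
    cases h
    rfl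
  · rintro ⟨⟨U, hU⟩, f⟩
    exact ⟨Cell₁.mk G P X Y (Kleisli.mk M U) hU f, rfl⟩
  · exact fun _ _ h => reparam_injective h
  · ext φ
    exact ⟨fun ⟨ψ, h⟩ => h ▸ reparam_w ψ, fun h => ⟨cell₂ φ h, rfl⟩⟩
  · refine Cell₁.ext_of_arr (X := X) (Y := Z) rfl ?_
    refine (Category.id_comp _).trans ((arr_comp f g).trans ?_).symm
    exact congrArg ((f.arr ⊗ₘ g.arr) ≫ ·) (toKleisli_μ_map F M (eComp V X Y Z))
  · exact (id_eq_elemCell G P X).trans (congrArg (Cell₁.mk G P X X (𝟙_ (Kleisli M)) P.prop_unit)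
      (toKleisli_ε_map F M (eId V X)))
  · intro X₁ Y₁ X₂ Y₂ f₁ f₂
    refine Cell₁.ext_of_arr (X := T.obj X₁ X₂) (Y := T.obj Y₁ Y₂) rfl ?_
    refine (Category.id_comp _).trans ((arr_tensorCell₁ G P T f₁ f₂).trans ?_).symm
    exact congrArg ((f₁.arr ⊗ₘ f₂.arr) ≫ ·) (toKleisli_μ_map F M (T.hom X₁ Y₁ X₂ Y₂))
  · exact fun _ _ _ _ _ _ _ _ _ _ => rfl
  · refine ⟨tensorStructure G P T, isIdentityCell_tensorStructure_mapId G P T,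
      fun _ _ _ _ _ _ _ _ _ _ => rfl, nearlyStrictMonoidal G P T, fun X Y Z => ?_, fun X => ?_,
      fun X => ?_, fun S => ⟨nearlyStrictSymmetric G P T S, fun X Y => ?_,
        fun X₁ Y₁ X₂ Y₂ f₁ f₂ => ?_⟩⟩
    · exact congrArg (Cell₁.mk G P (T.obj (T.obj X Y) Z) (T.obj X (T.obj Y Z)) (𝟙_ (Kleisli M))
        P.prop_unit) (toKleisli_ε_map F M (T.a X Y Z))
    · exact congrArg (Cell₁.mk G P (T.obj T.J X) X (𝟙_ (Kleisli M)) P.prop_unit)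
        (toKleisli_ε_map F M (T.l X))
    · exact congrArg (Cell₁.mk G P (T.obj X T.J) X (𝟙_ (Kleisli M)) P.prop_unit)
        (toKleisli_ε_map F M (T.r X))
    · exact congrArg (Cell₁.mk G P (T.obj X Y) (T.obj Y X) (𝟙_ (Kleisli M)) P.prop_unit)
        (toKleisli_ε_map F M (S.s X Y))
    · obtain ⟨h₁, e₁⟩ := IsEqToHom.rightUnitor (P := P) (A := f₁.dom ⊗ f₂.dom)
        (P.prop_tensor f₁.dom_mem f₂.dom_mem)
      obtain ⟨h₂, e₂⟩ := (IsEqToHom.leftUnitor (P := P) (A := f₂.dom ⊗ f₁.dom)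
        (P.prop_tensor f₂.dom_mem f₁.dom_mem)).inv (Iso.hom_inv_id _)
      refine ⟨h₁, h₂, ?_⟩
      exact congrArg₂ (fun x y => x ≫ (β_ f₁.dom f₂.dom).hom ≫ y) e₁ e₂
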